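/- **Crofton's inequality.** Let $L$ be a closed (compact, without boundary) smooth manifold, let $B$ be a compact smooth manifold, possibly with boundary, and let $ds$ be a smooth measure on $B$ (that is, in local coordinates, a smooth nonnegative density times Lebesgue measure). Let $(M,g)$ be a Riemannian manifold without boundary, not necessarily compact. Let $\Psi\colon B\times L\to M$ be a smooth map which is a submersion, i.e., the differential $D\Psi_{(s,x)}\colon T_{(s,x)}(B\times L)\to T_{\Psi(s,x)}M$ is surjective at every point $(s,x)\in B\times L$ (including the boundary points), and such that for every $s\in B$ the map $\Psi_s:=\Psi(s,\cdot)\colon L\to M$ is a smooth embedding. Write $L_s:=\Psi_s(L)$. Then there is a constant $C\ge 0$, depending only on $ds$, $\Psi$ and the metric $g$, such that for every closed (compact, without boundary) embedded smooth submanifold $L'\subset M$ with $\operatorname{codim} L'=\dim L$ the following holds. The number of intersection points $N(s):=|L_s\cap L'|$ is finite for $ds$-almost every $s\in B$, the function $N$ is integrable on $B$, and $$ \int_B N(s)\,ds\;\le\; C\cdot\operatorname{vol}(L'), $$ where $\operatorname{vol}(L')$ is the Riemannian volume of $L'$ for the metric induced by $g$. -/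

import Mathlib

open MeasureTheory Set Manifold
open scoped ContDiff ENNReal Topology

universe u

noncomputable section

namespace Crofton

section ChartMeasure

variable {d : ℕ} {H : Type*} [TopologicalSpace H]
  (I : ModelWithCorners ℝ (EuclideanSpace ℝ (Fin d)) H)
  {X : Type*} [TopologicalSpace X] [ChartedSpace H X]

lemma measurableSet_extChartAt_target (p : X) : MeasurableSet (extChartAt I p).target := by
  rw [extChartAt_target]
  exact ((chartAt H p).open_target.preimage I.continuous_symm).measurableSet.inter
    I.isClosed_range.measurableSet

variable [MeasurableSpace X]

/-- The measure on `X`, carried by the domain of the preferred chart at `p`, which in the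
coordinates of that chart is `ρ` times Lebesgue measure. -/
def chartMeasure (p : X) (ρ : EuclideanSpace ℝ (Fin d) → ℝ≥0∞) : Measure X :=
  ((volume.restrict (extChartAt I p).target).withDensity ρ).map (extChartAt I p).symm

/-- A smooth measure on a manifold, possibly with boundary: in each chart it has a smooth (up to
the boundary) nonnegative density with respect to Lebesgue measure. -/
def IsSmoothMeasure (μ : Measure X) : Prop :=
  ∀ p : X, ∃ ρ : EuclideanSpace ℝ (Fin d) → ℝ,
    ContDiffOn ℝ ∞ ρ (extChartAt I p).target ∧
    (∀ y ∈ (extChartAt I p).target, 0 ≤ ρ y) ∧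
    μ.restrict (extChartAt I p).source = chartMeasure I p (fun y ↦ ENNReal.ofReal (ρ y))

/-- The push-forward in `chartMeasure` is along an almost everywhere measurable map, so that it
takes the expected values. -/
lemma chartMeasure_apply [BorelSpace X] (p : X) (ρ : EuclideanSpace ℝ (Fin d) → ℝ≥0∞)
    {A : Set X} (hA : MeasurableSet A) (hAp : A ⊆ (extChartAt I p).source) :
    chartMeasure I p ρ A = ∫⁻ y in extChartAt I p '' A, ρ y := by
  have hT := measurableSet_extChartAt_target I p
  have hm : AEMeasurable (extChartAt I p).symm (volume.restrict (extChartAt I p).target) :=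
    (continuousOn_extChartAt_symm p).aemeasurable hT
  have hset : extChartAt I p '' A =
      (extChartAt I p).target ∩ (extChartAt I p).symm ⁻¹' A :=
    (extChartAt I p).image_eq_target_inter_inv_preimage hAp
  have hn : NullMeasurableSet ((extChartAt I p).symm ⁻¹' A)
      (volume.restrict (extChartAt I p).target) := hm.nullMeasurableSet_preimage hA
  have hac : (volume.restrict (extChartAt I p).target).withDensity ρ ≪
      volume.restrict (extChartAt I p).target := withDensity_absolutelyContinuous _ _
  rw [chartMeasure, Measure.map_apply_of_aemeasurable (hm.mono_ac hac) hA,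
    withDensity_apply₀ _ hn, Measure.restrict_restrict₀ hn, hset, inter_comm]

end ChartMeasure

section Volume

variable {n m : ℕ}
  {M : Type*} [TopologicalSpace M] [ChartedSpace (EuclideanSpace ℝ (Fin n)) M]
  [IsManifold (𝓡 n) ∞ M]
  {N : Type*} [TopologicalSpace N] [ChartedSpace (EuclideanSpace ℝ (Fin m)) N]

/-- The coordinate vector field `∂ f / ∂ y_i`, in the chart of `N` at `p`, at the point with
coordinates `y`. -/
def coordVector (f : N → M) (p : N) (y : EuclideanSpace ℝ (Fin m)) (i : Fin m) :
    TangentSpace (𝓡 n) (f ((extChartAt (𝓡 m) p).symm y)) :=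
  mfderiv 𝓘(ℝ, EuclideanSpace ℝ (Fin m)) (𝓡 n) (fun z ↦ f ((extChartAt (𝓡 m) p).symm z)) y
    (EuclideanSpace.single i (1 : ℝ))

variable (g : Bundle.ContMDiffRiemannianMetric (𝓡 n) ∞ (EuclideanSpace ℝ (Fin n))
  (fun x : M ↦ TangentSpace (𝓡 n) x))

/-- The matrix of the pulled back metric `f^* g` in the chart of `N` at `p`. -/
def gramMatrix (f : N → M) (p : N) (y : EuclideanSpace ℝ (Fin m)) : Matrix (Fin m) (Fin m) ℝ :=
  Matrix.of fun i j ↦ g.inner (f ((extChartAt (𝓡 m) p).symm y))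
    (coordVector f p y i) (coordVector f p y j)

/-- The Riemannian volume measure on `N` of the metric `f^* g` induced by an immersion
`f : N → M`. In each chart it is given by the density `√ det (f^* g)_{ij}`. These measures agree
on the overlaps of the charts, and the volume is the least measure that is, on each
chart domain, at least the one given there. -/
def inducedVolume [MeasurableSpace N] (f : N → M) : Measure N :=
  ⨆ p : N, chartMeasure (𝓡 m) p fun y ↦ ENNReal.ofReal (√(gramMatrix g f p y).det)

end Volume

end Crofton

end

/-! Work near a point $(s_0,x_0)$, in charts. There $\Psi$ becomes a map $\psi(s,w)$ whose
derivative is surjective and is injective in the direction of $w$. Hence $k$ linear functions $q(s)$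
of the parameter alone complete $\psi$ to a local diffeomorphism $(s,w)\mapsto(\psi(s,w),q(s))$,
with inverse $\Theta$. If $L'$ is parametrized by $J(y)$, then $\psi(s,w)=J(y)$ forces $s$ to be the
first component of $\Theta(J(y),q(s))$. So every intersection point of $L_s$ and $L'$ gives a
preimage $(y,q(s))$ of $s$ under $F(y,t)=\mathrm{pr}_1\Theta(J(y),t)$.

The codimension condition says $m+k=d$, so $F$ maps between spaces of equal dimension. The area
inequality (`exists_measurable_encard_fiber_le`) bounds the integral of the number of preimages by
$\int|\det F'|$. A linear algebra estimate (`exists_abs_det_comp_prodMap_le`) bounds $|\det F'|$ by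
a constant times the volume density of $L'$, and $t$ stays in a bounded ball. The constant involves
$\Psi$, $g$ and $ds$ near the point, but not $L'$ (`exists_local_crofton`, `exists_nhds_crofton`).

Finitely many such neighbourhoods cover the compact $B\times L$, and $L'$ is cut into finitely many
chart pieces; summing gives the bound. At boundary points of $B$ the inverse $\Theta$ is built from
the interior side only, the boundary being a null set. -/

namespace Crofton

/-! ### The area inequality with multiplicities -/

section Area

open MeasurableSpace Filter

variable {E : Type*} [NormedAddCommGroup E] [NormedSpace ℝ E] [FiniteDimensional ℝ E]
  [MeasurableSpace E] [BorelSpace E]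

lemma coe_encard_le_of_forall_finset {α : Type*} {S : Set α} {b : ℝ≥0∞}
    (h : ∀ Z : Finset α, (Z : Set α) ⊆ S → (Z.card : ℝ≥0∞) ≤ b) : (S.encard : ℝ≥0∞) ≤ b := by
  by_cases hS : S.Finite
  · have := h hS.toFinset (by simp)
    rw [hS.encard_eq_coe_toFinset_card]
    simpa using this
  · have hb : b = ⊤ := by
      refine ENNReal.eq_top_of_forall_nnreal_le fun r ↦ ?_
      obtain ⟨k, hk⟩ := exists_nat_ge r
      obtain ⟨Z, hZ, hc⟩ := Set.Infinite.exists_subset_card_eq hS k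
      refine le_trans ?_ (h Z hZ)
      rw [hc]
      exact_mod_cast hk
    simp [hb]

/-- An inequality in the area formula: the number of preimages under a differentiable map has a
measurable majorant with integral at most that of the Jacobian. -/
lemma exists_measurable_encard_fiber_le (μ : Measure E) [μ.IsAddHaarMeasure]
    {S : Set E} (hS : MeasurableSet S) {F : E → E} {F' : E → E →L[ℝ] E}
    (hF : ∀ x ∈ S, HasFDerivWithinAt F (F' x) S x) :
    ∃ h : E → ℝ≥0∞, Measurable h ∧ (∀ s, ((S ∩ F ⁻¹' {s}).encard : ℝ≥0∞) ≤ h s) ∧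
      ∫⁻ s, h s ∂μ ≤ ∫⁻ x in S, ENNReal.ofReal |(F' x).det| ∂μ := by
  classical
  -- The first `n` bits of an injective measurable code. They cut `S` into finitely many measurable
  -- pieces, and any two given points are separated for large `n`.
  let code : (n : ℕ) → E → (Fin n → Bool) := fun n x i ↦ mapNatBool E x i
  have hcode : ∀ n, Measurable (code n) := fun n ↦
    measurable_pi_iff.2 fun i ↦ (measurable_pi_iff.1 (measurable_mapNatBool E)) i
  let P : (n : ℕ) → (Fin n → Bool) → Set E := fun n c ↦ S ∩ code n ⁻¹' {c}
  have hP : ∀ n c, MeasurableSet (P n c) := fun n c ↦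
    hS.inter (hcode n (measurableSet_singleton c))
  -- A measurable hull of the image has the same measure, so measurability of the image itself is
  -- not needed.
  let A : (n : ℕ) → (Fin n → Bool) → Set E := fun n c ↦ toMeasurable μ (F '' P n c)
  let g : ℕ → E → ℝ≥0∞ := fun n s ↦ ∑ c, (A n c).indicator 1 s
  have hg : ∀ n, Measurable (g n) := fun n ↦
    Finset.measurable_sum _ fun c _ ↦ measurable_one.indicator (measurableSet_toMeasurable _ _)
  have hint : ∀ n, ∫⁻ s, g n s ∂μ ≤ ∫⁻ x in S, ENNReal.ofReal |(F' x).det| ∂μ := by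
    intro n
    have hSU : S = ⋃ c, P n c := by
      ext x; simp [P]
    rw [lintegral_finsetSum _ fun c _ ↦ measurable_one.indicator (measurableSet_toMeasurable _ _)]
    conv_rhs => rw [hSU]
    rw [lintegral_iUnion (hP n), tsum_fintype]
    · refine Finset.sum_le_sum fun c _ ↦ ?_
      rw [lintegral_indicator_one (measurableSet_toMeasurable _ _), measure_toMeasurable]
      exact addHaar_image_le_lintegral_abs_det_fderiv μ (hP n c) fun x hx ↦
        (hF x hx.1).mono inter_subset_left
    · intro c c' hcc
      refine Set.disjoint_left.2 fun x hx hx' ↦ hcc ?_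
      exact hx.2.symm.trans hx'.2
  -- A finite part of a fibre eventually has its points in distinct pieces, whence the lower bound
  -- on the lower limit; Fatou's lemma gives the integral.
  refine ⟨fun s ↦ liminf (fun n ↦ g n s) atTop, Measurable.liminf hg, fun s ↦ ?_, ?_⟩
  · refine coe_encard_le_of_forall_finset fun Z hZ ↦ ?_
    have hinj : ∀ᶠ n in atTop, InjOn (code n) (Z : Set E) := by
      have : ∀ x ∈ Z, ∀ y ∈ Z, ∀ᶠ n in atTop, code n x = code n y → x = y := by
        intro x _ y _
        by_cases hxy : x = y
        · simp [hxy]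
        · obtain ⟨j, hj⟩ : ∃ j, mapNatBool E x j ≠ mapNatBool E y j := by
            by_contra! hcon
            exact hxy (injective_mapNatBool E (funext hcon))
          filter_upwards [eventually_gt_atTop j] with n hn hc
          exact absurd (congrFun hc ⟨j, hn⟩) hj
      have h2 : ∀ᶠ n in atTop, ∀ x ∈ Z, ∀ y ∈ Z, code n x = code n y → x = y := by
        rw [Filter.eventually_all_finset]
        intro x hx
        rw [Filter.eventually_all_finset]
        exact this x hx
      filter_upwards [h2] with n hn x hx y hy hxy using hn x hx y hy hxy
    refine le_liminf_of_le (by isBoundedDefault) ?_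
    filter_upwards [hinj] with n hn
    calc (Z.card : ℝ≥0∞) = ((Z.image (code n)).card : ℝ≥0∞) := by
          rw [Finset.card_image_of_injOn hn]
      _ = ∑ c ∈ Z.image (code n), 1 := by simp
      _ ≤ ∑ c ∈ Z.image (code n), (A n c).indicator 1 s := by
          refine Finset.sum_le_sum fun c hc ↦ ?_
          obtain ⟨x, hx, rfl⟩ := Finset.mem_image.1 hc
          have hxS := hZ hx
          have : s ∈ A n (code n x) := subset_toMeasurable _ _ ⟨x, ⟨hxS.1, rfl⟩, hxS.2⟩
          simp [this]
      _ ≤ g n s := Finset.sum_le_sum_of_subset (Finset.subset_univ _)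
  · calc _ ≤ liminf (fun n ↦ ∫⁻ s, g n s ∂μ) atTop := lintegral_liminf_le hg
      _ ≤ _ := liminf_le_of_frequently_le' (Frequently.of_forall hint)

end Area

/-! ### Linear completion and determinant bounds -/

section LinearAlgebra

open scoped MatrixOrder Matrix.Norms.L2Operator

/-- A surjective linear map on a product, injective on the second factor, is completed to an
isomorphism by a linear map on the first factor. -/
lemma exists_prod_comp_fst_equiv {X W Z : Type*}
    [NormedAddCommGroup X] [NormedSpace ℝ X] [FiniteDimensional ℝ X]
    [NormedAddCommGroup W] [NormedSpace ℝ W] [FiniteDimensional ℝ W]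
    [NormedAddCommGroup Z] [NormedSpace ℝ Z] [FiniteDimensional ℝ Z]
    (A : X × W →L[ℝ] Z) (hA : Function.Surjective A) (hA' : ∀ w, A (0, w) = 0 → w = 0) :
    ∃ (k : ℕ) (q : X →L[ℝ] EuclideanSpace ℝ (Fin k))
      (e : (X × W) ≃L[ℝ] Z × EuclideanSpace ℝ (Fin k)),
      (e : X × W →L[ℝ] Z × EuclideanSpace ℝ (Fin k)) =
        A.prod (q.comp (ContinuousLinearMap.fst ℝ X W)) := by
  let K := LinearMap.ker (A : X × W →ₗ[ℝ] Z)
  let f : K →ₗ[ℝ] X := (LinearMap.fst ℝ X W).comp K.subtype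
  have hf : LinearMap.ker f = ⊥ := by
    rw [LinearMap.ker_eq_bot']
    rintro ⟨⟨x, w⟩, hv⟩ h0
    have hx : x = 0 := h0
    subst hx
    have hw := hA' w hv
    subst hw
    rfl
  -- The kernel of `A` meets the second factor trivially, so it projects injectively to `X`. A left
  -- inverse of this projection detects the kernel, which makes `(A, q)` injective; the dimensions
  -- agree by rank-nullity.
  obtain ⟨q₀, hq₀⟩ := f.exists_leftInverse_of_injective hf
  let j : K ≃ₗ[ℝ] EuclideanSpace ℝ (Fin (Module.finrank ℝ K)) :=
    LinearEquiv.ofFinrankEq _ _ (by simp)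
  let q : X →L[ℝ] EuclideanSpace ℝ (Fin (Module.finrank ℝ K)) :=
    LinearMap.toContinuousLinearMap (j.toLinearMap.comp q₀)
  let T := A.prod (q.comp (ContinuousLinearMap.fst ℝ X W))
  have hinj : Function.Injective (T : X × W →ₗ[ℝ]
      Z × EuclideanSpace ℝ (Fin (Module.finrank ℝ K))) := by
    rw [← LinearMap.ker_eq_bot, LinearMap.ker_eq_bot']
    intro v hv
    have h1 : A v = 0 := congrArg Prod.fst hv
    have h2 : j (q₀ v.1) = 0 := congrArg Prod.snd hv
    have h3 : q₀ v.1 = ⟨v, h1⟩ := LinearMap.congr_fun hq₀ ⟨v, h1⟩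
    rw [h3] at h2
    have h4 := j.map_eq_zero_iff.1 h2
    exact congrArg Subtype.val h4
  have hdim : Module.finrank ℝ (X × W) =
      Module.finrank ℝ (Z × EuclideanSpace ℝ (Fin (Module.finrank ℝ K))) := by
    have := LinearMap.finrank_range_add_finrank_ker (A : X × W →ₗ[ℝ] Z)
    rw [LinearMap.range_eq_top.2 hA, finrank_top] at this
    rw [← this, Module.finrank_prod, finrank_euclideanSpace_fin]
  refine ⟨_, q, (LinearEquiv.ofInjectiveOfFinrankEq (T : X × W →ₗ[ℝ]
    Z × EuclideanSpace ℝ (Fin (Module.finrank ℝ K))) hinj hdim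
    ).toContinuousLinearEquiv, ?_⟩
  ext v <;> rfl

lemma exists_abs_det_le {E : Type*} [NormedAddCommGroup E] [NormedSpace ℝ E]
    [FiniteDimensional ℝ E] (K : ℝ) :
    ∃ C : ℝ, 0 ≤ C ∧ ∀ T : E →L[ℝ] E, ‖T‖ ≤ K → |T.det| ≤ C := by
  have hc : IsCompact (Metric.closedBall (0 : E →L[ℝ] E) K) := isCompact_closedBall _ _
  obtain ⟨C, hC⟩ := hc.exists_bound_of_continuousOn
    (f := fun T : E →L[ℝ] E ↦ T.det) ContinuousLinearMap.continuous_det.continuousOn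
  refine ⟨max C 0, le_max_right _ _, fun T hT ↦ le_max_of_le_left ?_⟩
  exact hC T (by simpa using hT)

/-- Volume distortion of a linear map through a metric given by its Gram matrix. -/
lemma exists_abs_det_comp_prodMap_le {m : ℕ} {Z T : Type*}
    [NormedAddCommGroup Z] [NormedSpace ℝ Z]
    [NormedAddCommGroup T] [NormedSpace ℝ T] [FiniteDimensional ℝ T] (K c : ℝ) :
    ∃ C : ℝ, 0 ≤ C ∧ ∀ (Q : Z × T →L[ℝ] EuclideanSpace ℝ (Fin m) × T)
      (J : EuclideanSpace ℝ (Fin m) →L[ℝ] Z) (A : Matrix (Fin m) (Fin m) ℝ),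
      ‖Q‖ ≤ K → A.PosSemidef →
      (∀ v : Fin m → ℝ, ‖J (WithLp.toLp 2 v)‖ ^ 2 ≤ c ^ 2 * (v ⬝ᵥ A.mulVec v)) →
      |(Q.comp (J.prodMap (ContinuousLinearMap.id ℝ T))).det| ≤ C * √A.det := by
  obtain ⟨C, hC0, hC⟩ := exists_abs_det_le (E := EuclideanSpace ℝ (Fin m) × T)
    (|K| * max |c| 1)
  refine ⟨C, hC0, fun Q J A hQ hA hJ ↦ ?_⟩
  -- If the Gram matrix is degenerate, a null vector of it is killed by `J`, and both sides vanish.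
  -- Otherwise write `A = Rᵀ R`: then `J R⁻¹` has norm at most `|c|`, and the remaining factor `R`
  -- contributes `|det R| = √(det A)`.
  by_cases hdet : A.det = 0
  · obtain ⟨v, hv0, hv⟩ := Matrix.exists_mulVec_eq_zero_iff.2 hdet
    have hJv : J (WithLp.toLp 2 v) = 0 := by
      have := hJ v
      rw [hv, dotProduct_zero, mul_zero] at this
      exact norm_eq_zero.1 (pow_eq_zero_iff two_ne_zero |>.1 (le_antisymm this (by positivity)))
    have h0 : (Q.comp (J.prodMap (ContinuousLinearMap.id ℝ T))).det = 0 := by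
      by_contra hne
      have hk := (LinearMap.equivOfDetNeZero _ hne).injective
      have : (WithLp.toLp 2 v, (0 : T)) = 0 := hk (by
        change Q (J (WithLp.toLp 2 v), (0 : T)) = (Q.comp (J.prodMap (ContinuousLinearMap.id ℝ T))) 0
        rw [hJv, map_zero]
        exact map_zero Q)
      have h1 : WithLp.toLp 2 v = 0 := congrArg Prod.fst this
      exact hv0 (by simpa using h1)
    rw [h0, abs_zero]
    positivity
  · obtain ⟨R, hR⟩ := CStarAlgebra.nonneg_iff_eq_star_mul_self.1 hA.nonneg
    have hRT : A = R.transpose * R := by rw [hR, Matrix.star_eq_conjTranspose, Matrix.conjTranspose_eq_transpose_of_trivial]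
    have hdetR : A.det = R.det ^ 2 := by rw [hRT, Matrix.det_mul, Matrix.det_transpose, sq]
    have hu : IsUnit R.det := by
      rw [isUnit_iff_ne_zero]; intro h; exact hdet (by rw [hdetR, h]; simp)
    let r : EuclideanSpace ℝ (Fin m) →L[ℝ] EuclideanSpace ℝ (Fin m) :=
      LinearMap.toContinuousLinearMap (Matrix.toEuclideanLin R)
    let r' : EuclideanSpace ℝ (Fin m) →L[ℝ] EuclideanSpace ℝ (Fin m) :=
      LinearMap.toContinuousLinearMap (Matrix.toEuclideanLin R⁻¹)
    have hrr : ∀ v, r' (r v) = v := by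
      intro v
      ext i
      simp [r, r', Matrix.toEuclideanLin, Matrix.nonsing_inv_mul _ hu]
    have hJ0 : ‖J.comp r'‖ ≤ |c| := by
      refine ContinuousLinearMap.opNorm_le_bound _ (abs_nonneg _) fun v ↦ ?_
      refine abs_le_of_sq_le_sq' ?_ (by positivity) |>.2
      have := hJ (R⁻¹.mulVec v)
      have h2 : (R⁻¹.mulVec v) ⬝ᵥ A.mulVec (R⁻¹.mulVec v) = ‖v‖ ^ 2 := by
        rw [hRT, Matrix.mulVec_mulVec, Matrix.mul_assoc, Matrix.mul_nonsing_inv _ hu, mul_one,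
          Matrix.mulVec_transpose, dotProduct_comm, ← Matrix.dotProduct_mulVec,
          Matrix.mulVec_mulVec, Matrix.mul_nonsing_inv _ hu, Matrix.one_mulVec,
          EuclideanSpace.norm_sq_eq]
        simp [dotProduct, sq]
      rw [h2] at this
      rw [mul_pow, sq_abs]
      exact this
    have hfac : Q.comp (J.prodMap (ContinuousLinearMap.id ℝ T)) =
        (Q.comp ((J.comp r').prodMap (ContinuousLinearMap.id ℝ T))).comp
          (r.prodMap (ContinuousLinearMap.id ℝ T)) := by
      refine ContinuousLinearMap.ext fun v ↦ ?_
      simp [Prod.map, hrr]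
    have hdetr : (r.prodMap (ContinuousLinearMap.id ℝ T)).det = R.det := by
      have : ((r.prodMap (ContinuousLinearMap.id ℝ T) : _ →L[ℝ] _) :
          EuclideanSpace ℝ (Fin m) × T →ₗ[ℝ] EuclideanSpace ℝ (Fin m) × T) =
          (Matrix.toEuclideanLin R).prodMap LinearMap.id := rfl
      rw [ContinuousLinearMap.det, this, LinearMap.det_prodMap, LinearMap.det_id, mul_one]
      simp
    have hmul : (Q.comp (J.prodMap (ContinuousLinearMap.id ℝ T))).det =
        (Q.comp ((J.comp r').prodMap (ContinuousLinearMap.id ℝ T))).det * R.det := by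
      rw [hfac, ← hdetr]
      exact LinearMap.det_comp _ _
    rw [hmul, abs_mul, hdetR, Real.sqrt_sq_eq_abs]
    refine mul_le_mul_of_nonneg_right (hC _ ?_) (abs_nonneg _)
    refine (ContinuousLinearMap.opNorm_comp_le _ _).trans ?_
    refine mul_le_mul (hQ.trans (le_abs_self _)) ?_ (norm_nonneg _) (abs_nonneg _)
    refine ContinuousLinearMap.opNorm_le_bound _ (by positivity) fun v ↦ ?_
    rw [Prod.norm_def]
    refine max_le ?_ ?_
    · refine ((J.comp r').le_opNorm v.1).trans ?_
      exact mul_le_mul (hJ0.trans (le_max_left _ _)) (norm_fst_le v) (norm_nonneg _) (by positivity)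
    · refine (norm_snd_le v).trans ?_
      exact le_mul_of_one_le_left (norm_nonneg _) (le_max_right _ _)

end LinearAlgebra

/-! ### The inverse function theorem at a boundary point -/

section LocalInverse

variable {X W Z T : Type*}
  [NormedAddCommGroup X] [NormedSpace ℝ X] [FiniteDimensional ℝ X]
  [NormedAddCommGroup W] [NormedSpace ℝ W] [FiniteDimensional ℝ W]
  [NormedAddCommGroup Z] [NormedSpace ℝ Z]
  [NormedAddCommGroup T] [NormedSpace ℝ T]

/-- Linear maps close to an isomorphism are isomorphisms with a bounded inverse. -/
lemma eventually_near_equiv {E F : Type*} [NormedAddCommGroup E] [NormedSpace ℝ E]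
    [CompleteSpace E] [NormedAddCommGroup F] [NormedSpace ℝ F] (e : E ≃L[ℝ] F)
    {ε : ℝ} (hε : 0 < ε) :
    ∀ᶠ B : E →L[ℝ] F in 𝓝 (e : E →L[ℝ] F), ‖B - (e : E →L[ℝ] F)‖ ≤ ε ∧
      ∃ B' : E ≃L[ℝ] F, (B' : E →L[ℝ] F) = B ∧
        ‖(B'.symm : F →L[ℝ] E)‖ ≤ ‖(e.symm : F →L[ℝ] E)‖ + 1 := by
  have h2 : ContinuousAt ContinuousLinearMap.inverse (e : E →L[ℝ] F) :=
    (contDiffAt_map_inverse (n := 0) e).continuousAt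
  have h3 : ∀ᶠ B in 𝓝 (e : E →L[ℝ] F),
      ‖ContinuousLinearMap.inverse B‖ < ‖(e.symm : F →L[ℝ] E)‖ + 1 := by
    refine h2.norm.eventually_lt continuousAt_const ?_
    simp
  have h4 : ∀ᶠ B in 𝓝 (e : E →L[ℝ] F), ‖B - (e : E →L[ℝ] F)‖ < ε := by
    have : ContinuousAt (fun B : E →L[ℝ] F ↦ ‖B - (e : E →L[ℝ] F)‖) (e : E →L[ℝ] F) :=
      (continuousAt_id.sub continuousAt_const).norm
    refine this.eventually_lt continuousAt_const ?_
    simpa using hε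
  filter_upwards [ContinuousLinearEquiv.nhds e, h3, h4] with B hB1 hB2 hB3
  obtain ⟨B', rfl⟩ := hB1
  rw [ContinuousLinearMap.inverse_equiv] at hB2
  exact ⟨hB3.le, B', rfl, hB2.le⟩

lemma inl_comp_add_inr_comp {E F G : Type*} [NormedAddCommGroup E] [NormedSpace ℝ E]
    [NormedAddCommGroup F] [NormedSpace ℝ F] [NormedAddCommGroup G] [NormedSpace ℝ G]
    (a : E →L[ℝ] F) (b : E →L[ℝ] G) :
    (ContinuousLinearMap.inl ℝ F G).comp a + (ContinuousLinearMap.inr ℝ F G).comp b =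
      a.prod b := by
  refine ContinuousLinearMap.ext fun v ↦ ?_
  simp

set_option maxHeartbeats 1000000 in
/-- An inverse function theorem up to the boundary of a convex set: the map is inverted on the
interior, with a bound for the derivative of the inverse. -/
lemma exists_local_inverse {R : Set X} (hR : Convex ℝ R) (hRi : (interior R).Nonempty)
    {x₀ : X} (hx₀ : x₀ ∈ R) (w₀ : W) {ψ : X × W → Z}
    (hψ : ContDiffWithinAt ℝ 1 ψ (R ×ˢ univ) (x₀, w₀)) {A : X × W →L[ℝ] Z}
    (hA : HasFDerivWithinAt ψ A (R ×ˢ univ) (x₀, w₀)) (q : X →L[ℝ] T) (e : (X × W) ≃L[ℝ] Z × T)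
    (he : (e : X × W →L[ℝ] Z × T) = A.prod (q.comp (ContinuousLinearMap.fst ℝ X W))) :
    ∃ r > 0, ∃ (K : ℝ) (Θ : Z × T → X × W) (Ω : Set (Z × T)), IsOpen Ω ∧
      (∀ s ∈ Metric.ball x₀ r ∩ interior R, ∀ w ∈ Metric.ball w₀ r,
        (ψ (s, w), q s) ∈ Ω ∧ Θ (ψ (s, w), q s) = (s, w)) ∧
      ∀ u ∈ Ω, ∃ Θ' : Z × T →L[ℝ] X × W, HasFDerivAt Θ Θ' u ∧ ‖Θ'‖ ≤ K := by
  have : CompleteSpace (X × W) := FiniteDimensional.complete ℝ _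
  set S : Set (X × W) := R ×ˢ univ with hSdef
  have hcS : (x₀, w₀) ∈ S := ⟨hx₀, mem_univ _⟩
  obtain ⟨u, hu, -, f', hf', hf'c⟩ :=
    (contDiffWithinAt_succ_iff_hasFDerivWithinAt (n := 0) (by simp)).1 (by simpa using hψ)
  rw [insert_eq_of_mem hcS] at hu
  have hcu : (x₀, w₀) ∈ u := mem_of_mem_nhdsWithin hcS hu
  have hSu : UniqueDiffWithinAt ℝ S (x₀, w₀) := by
    refine uniqueDiffWithinAt_convex (hR.prod convex_univ) ?_ (subset_closure hcS)
    rw [hSdef, interior_prod_eq, interior_univ]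
    exact hRi.prod univ_nonempty
  have hf'A : f' (x₀, w₀) = A := hSu.eq ((hf' _ hcu).mono_of_mem_nhdsWithin hu) hA
  -- This is `(f' v).prod (q ∘ fst)`, as a sum of compositions whose continuity in `v` is immediate.
  let G' : X × W → X × W →L[ℝ] Z × T := fun v ↦
    (ContinuousLinearMap.inl ℝ Z T).comp (f' v) +
      (ContinuousLinearMap.inr ℝ Z T).comp (q.comp (ContinuousLinearMap.fst ℝ X W))
  have hG'e : G' (x₀, w₀) = e := by
    rw [he, ← hf'A]
    exact inl_comp_add_inr_comp _ _
  have hG'c : ContinuousWithinAt G' u (x₀, w₀) :=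
    (continuousWithinAt_const.clm_comp hf'c.continuousWithinAt).add continuousWithinAt_const
  -- A map this close to `e`, in the Lipschitz sense, is injective and open.
  obtain ⟨ε, hε0, hε⟩ : ∃ ε : NNReal, 0 < ε ∧
      (Subsingleton (X × W) ∨ ε < ‖(e.symm : Z × T →L[ℝ] X × W)‖₊⁻¹) := by
    rcases e.subsingleton_or_nnnorm_symm_pos with h | h
    · exact ⟨1, one_pos, Or.inl h⟩
    · exact ⟨‖(e.symm : Z × T →L[ℝ] X × W)‖₊⁻¹ / 2, by positivity,
        Or.inr (NNReal.half_lt_self (by positivity))⟩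
  set K : ℝ := ‖(e.symm : Z × T →L[ℝ] X × W)‖ + 1
  have hgood := eventually_near_equiv e (NNReal.coe_pos.2 hε0)
  have hev : ∀ᶠ v in 𝓝[S] (x₀, w₀), v ∈ u ∧ ‖G' v - (e : X × W →L[ℝ] Z × T)‖ ≤ ε ∧
      ∃ B' : (X × W) ≃L[ℝ] Z × T, (B' : X × W →L[ℝ] Z × T) = G' v ∧
        ‖(B'.symm : Z × T →L[ℝ] X × W)‖ ≤ K := by
    refine Filter.Eventually.and hu ?_
    rw [← hG'e] at hgood
    have h1 := hG'c.eventually hgood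
    rw [hG'e] at h1
    exact nhdsWithin_le_of_mem hu h1
  obtain ⟨r, hr, hball⟩ := Metric.mem_nhdsWithin_iff.1 hev
  -- Open, so that derivatives within `S` are full derivatives, and convex, for the mean value
  -- inequality. The base point may lie outside `V`; only the estimates come from it.
  let V : Set (X × W) := (Metric.ball x₀ r ∩ interior R) ×ˢ Metric.ball w₀ r
  have hVo : IsOpen V := (Metric.isOpen_ball.inter isOpen_interior).prod Metric.isOpen_ball
  have hVc : Convex ℝ V := ((convex_ball _ _).inter hR.interior).prod (convex_ball _ _)
  have hVS : V ⊆ Metric.ball (x₀, w₀) r ∩ S := by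
    rintro ⟨s, w⟩ ⟨hs, hw⟩
    refine ⟨?_, interior_subset hs.2, mem_univ _⟩
    rw [← ball_prod_same]
    exact ⟨hs.1, hw⟩
  have hVu : ∀ v ∈ V, u ∈ 𝓝 v := fun v hv ↦
    Filter.mem_of_superset (hVo.mem_nhds hv) fun v' hv' ↦ (hball (hVS hv')).1
  let G : X × W → Z × T := fun v ↦ (ψ v, q v.1)
  have hG : ∀ v ∈ V, HasFDerivAt G (G' v) v := by
    intro v hv
    have h1 : HasFDerivAt ψ (f' v) v := (hf' v (mem_of_mem_nhds (hVu v hv))).hasFDerivAt (hVu v hv)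
    have h2 : HasFDerivAt (fun v : X × W ↦ q v.1)
      (q.comp (ContinuousLinearMap.fst ℝ X W)) v :=
      (q.comp (ContinuousLinearMap.fst ℝ X W)).hasFDerivAt
    have h3 := h1.prodMk h2
    rw [← inl_comp_add_inr_comp] at h3
    exact h3
  have happ : ApproximatesLinearOn G (e : X × W →L[ℝ] Z × T) V ε := by
    intro x hx y hy
    exact hVc.norm_image_sub_le_of_norm_hasFDerivWithin_le'
      (fun v hv ↦ (hG v hv).hasFDerivWithinAt) (fun v hv ↦ (hball (hVS hv)).2.1) hy hx
  let Φ := happ.toOpenPartialHomeomorph G V hε hVo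
  refine ⟨r, hr, K, Φ.symm, Φ.target, Φ.open_target, fun s hs w hw ↦ ?_, fun z hz ↦ ?_⟩
  · have hv : (s, w) ∈ Φ.source := ⟨hs, hw⟩
    exact ⟨Φ.map_source hv, Φ.left_inv hv⟩
  · have hv : Φ.symm z ∈ V := Φ.map_target hz
    obtain ⟨B', hB', hB'K⟩ := (hball (hVS hv)).2.2
    refine ⟨B'.symm, Φ.hasFDerivAt_symm hz ?_, hB'K⟩
    rw [hB']
    exact hG _ hv

end LocalInverse

/-! ### The estimate in coordinates -/

section LocalCrofton

variable {d m : ℕ} {W Z : Type*}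
  [NormedAddCommGroup W] [NormedSpace ℝ W] [FiniteDimensional ℝ W]
  [NormedAddCommGroup Z] [NormedSpace ℝ Z] [FiniteDimensional ℝ Z]

/-- Crofton's inequality in coordinates. -/
lemma exists_local_crofton
    (hdim : m + Module.finrank ℝ W = Module.finrank ℝ Z)
    {R : Set (EuclideanSpace ℝ (Fin d))} (hR : Convex ℝ R) (hRi : (interior R).Nonempty)
    {x₀ : EuclideanSpace ℝ (Fin d)} (hx₀ : x₀ ∈ R) (w₀ : W)
    {ψ : EuclideanSpace ℝ (Fin d) × W → Z}
    (hψ : ContDiffWithinAt ℝ 1 ψ (R ×ˢ univ) (x₀, w₀))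
    {A : EuclideanSpace ℝ (Fin d) × W →L[ℝ] Z}
    (hA : HasFDerivWithinAt ψ A (R ×ˢ univ) (x₀, w₀))
    (hAs : Function.Surjective A) (hAi : ∀ w, A (0, w) = 0 → w = 0) (c : ℝ) :
    ∃ r > 0, ∃ C : NNReal, ∀ (D : Set (EuclideanSpace ℝ (Fin m)))
      (J : EuclideanSpace ℝ (Fin m) → Z)
      (J' : EuclideanSpace ℝ (Fin m) → EuclideanSpace ℝ (Fin m) →L[ℝ] Z)
      (Q : EuclideanSpace ℝ (Fin m) → Matrix (Fin m) (Fin m) ℝ),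
      MeasurableSet D → (∀ y ∈ D, HasFDerivAt J (J' y) y) → (∀ y ∈ D, (Q y).PosSemidef) →
      (∀ y ∈ D, ∀ v : Fin m → ℝ,
        ‖J' y (WithLp.toLp 2 v)‖ ^ 2 ≤ c ^ 2 * (v ⬝ᵥ (Q y).mulVec v)) →
      AEMeasurable (fun y ↦ ENNReal.ofReal (√(Q y).det)) (volume.restrict D) →
      ∃ h : EuclideanSpace ℝ (Fin d) → ℝ≥0∞, Measurable h ∧
        (∀ s ∈ Metric.ball x₀ r ∩ interior R,
          ({y ∈ D | ∃ w ∈ Metric.ball w₀ r, ψ (s, w) = J y}.encard : ℝ≥0∞) ≤ h s) ∧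
        ∫⁻ s, h s ≤ C * ∫⁻ y in D, ENNReal.ofReal (√(Q y).det) := by
  obtain ⟨k, q, e, he⟩ := exists_prod_comp_fst_equiv A hAs hAi
  obtain ⟨r, hr, K, Θ, Ω, hΩ, hΘ, hΘ'⟩ := exists_local_inverse hR hRi hx₀ w₀ hψ hA q e he
  have hd : Module.finrank ℝ (EuclideanSpace ℝ (Fin d)) =
      Module.finrank ℝ (EuclideanSpace ℝ (Fin m) × EuclideanSpace ℝ (Fin k)) := by
    have := e.toLinearEquiv.finrank_eq
    simp only [Module.finrank_prod, finrank_euclideanSpace_fin] at this ⊢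
    omega
  -- Since `d = m + k`, this identification turns `F` into a self-map, at the cost of the scalar `κ`
  -- between the two Haar measures.
  let j : EuclideanSpace ℝ (Fin d) ≃L[ℝ] EuclideanSpace ℝ (Fin m) × EuclideanSpace ℝ (Fin k) :=
    ContinuousLinearEquiv.ofFinrankEq hd
  let P : EuclideanSpace ℝ (Fin d) × W →L[ℝ]
      EuclideanSpace ℝ (Fin m) × EuclideanSpace ℝ (Fin k) :=
    (j : EuclideanSpace ℝ (Fin d) →L[ℝ] _).comp (ContinuousLinearMap.fst ℝ _ W)
  obtain ⟨C, hC0, hC⟩ := exists_abs_det_comp_prodMap_le (m := m) (Z := Z)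
    (T := EuclideanSpace ℝ (Fin k)) (‖P‖ * K) c
  let μ : Measure (EuclideanSpace ℝ (Fin m) × EuclideanSpace ℝ (Fin k)) := volume.prod volume
  have hμ' : (volume.map j).IsAddHaarMeasure := j.isAddHaarMeasure_map volume
  let κ : NNReal := (volume.map j).addHaarScalarFactor μ
  have hκ : volume.map j = κ • μ := Measure.isAddLeftInvariant_eq_smul _ _
  -- Bounds the auxiliary variable `t = q s`, so that integrating over it costs only the volume of a
  -- ball.
  let β : ℝ := ‖q‖ * (‖x₀‖ + r)
  have hβ : ∀ s ∈ Metric.ball x₀ r, q s ∈ Metric.closedBall 0 β := by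
    intro s hs
    rw [mem_closedBall_zero_iff]
    refine (q.le_opNorm s).trans (mul_le_mul_of_nonneg_left ?_ (norm_nonneg _))
    have h1 := mem_ball_iff_norm.1 hs
    have h2 := norm_le_norm_add_norm_sub' s x₀
    linarith
  refine ⟨r, hr, κ * (C.toNNReal * (volume (Metric.closedBall (0 : EuclideanSpace ℝ (Fin k))
    β)).toNNReal), fun D J J' Q hD hJ hQ hJQ hQm ↦ ?_⟩
  let S : Set (EuclideanSpace ℝ (Fin m) × EuclideanSpace ℝ (Fin k)) :=
    (D ×ˢ Metric.closedBall 0 β) ∩ (fun z ↦ (J z.1, z.2)) ⁻¹' Ω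
  have hDm : MeasurableSet (D ×ˢ Metric.closedBall (0 : EuclideanSpace ℝ (Fin k)) β) :=
    hD.prod measurableSet_closedBall
  have hS : MeasurableSet S := by
    have hc : ContinuousOn (fun z : EuclideanSpace ℝ (Fin m) × EuclideanSpace ℝ (Fin k) ↦
        (J z.1, z.2)) (D ×ˢ Metric.closedBall 0 β) := fun z hz ↦
      ((((hJ z.1 hz.1).continuousAt).comp continuousAt_fst).prodMk
        continuousAt_snd).continuousWithinAt
    obtain ⟨O, hO, hOe⟩ := continuousOn_iff'.1 hc Ω hΩ
    have : S = O ∩ D ×ˢ Metric.closedBall 0 β := by rw [← hOe, inter_comm]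
    rw [this]
    exact hO.measurableSet.inter hDm
  choose! Θ' hΘd hΘK using hΘ'
  let F : EuclideanSpace ℝ (Fin m) × EuclideanSpace ℝ (Fin k) →
      EuclideanSpace ℝ (Fin m) × EuclideanSpace ℝ (Fin k) := fun z ↦ P (Θ (J z.1, z.2))
  let F' : EuclideanSpace ℝ (Fin m) × EuclideanSpace ℝ (Fin k) →
      EuclideanSpace ℝ (Fin m) × EuclideanSpace ℝ (Fin k) →L[ℝ]
      EuclideanSpace ℝ (Fin m) × EuclideanSpace ℝ (Fin k) := fun z ↦
    (P.comp (Θ' (J z.1, z.2))).comp ((J' z.1).prodMap (ContinuousLinearMap.id ℝ _))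
  have hF : ∀ z ∈ S, HasFDerivWithinAt F (F' z) S z := by
    intro z hz
    have h1 : HasFDerivAt (fun z : EuclideanSpace ℝ (Fin m) × EuclideanSpace ℝ (Fin k) ↦
        (J z.1, z.2)) ((J' z.1).prodMap (ContinuousLinearMap.id ℝ _)) z :=
      HasFDerivAt.prodMap z (hJ z.1 hz.1.1) (hasFDerivAt_id z.2)
    exact (((P.hasFDerivAt (x := Θ (J z.1, z.2))).comp z
      ((hΘd _ hz.2).comp z h1))).hasFDerivWithinAt
  obtain ⟨h, hm, hle, hint⟩ := exists_measurable_encard_fiber_le μ hS hF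
  refine ⟨fun s ↦ h (j s), hm.comp j.continuous.measurable, fun s hs ↦ ?_, ?_⟩
  · refine le_trans ?_ (hle (j s))
    rw [ENat.toENNReal_le]
    refine encard_le_encard_of_injOn (f := fun y ↦ (y, q s)) ?_ ?_
    · rintro y ⟨hy, w, hw, hyw⟩
      obtain ⟨h1, h2⟩ := hΘ s hs w hw
      rw [hyw] at h1 h2
      refine ⟨⟨⟨hy, hβ s hs.1⟩, h1⟩, ?_⟩
      change P (Θ (J y, q s)) = j s
      rw [h2]
      rfl
    · intro y _ y' _ hyy
      exact congrArg Prod.fst hyy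
  · have hb : ∀ z ∈ S, ENNReal.ofReal |(F' z).det| ≤
        ENNReal.ofReal C * ENNReal.ofReal (√(Q z.1).det) := by
      intro z hz
      rw [← ENNReal.ofReal_mul hC0]
      refine ENNReal.ofReal_le_ofReal (hC _ _ _ ?_ (hQ _ hz.1.1) (hJQ _ hz.1.1))
      exact (ContinuousLinearMap.opNorm_comp_le _ _).trans
        (mul_le_mul_of_nonneg_left (hΘK _ hz.2) (norm_nonneg _))
    calc ∫⁻ s, h (j s) = ∫⁻ z, h z ∂(volume.map j) :=
          (lintegral_map hm j.continuous.measurable).symm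
      _ = κ * ∫⁻ z, h z ∂μ := by
          rw [hκ, lintegral_smul_measure]
          rfl
      _ ≤ κ * ∫⁻ z in S, ENNReal.ofReal |(F' z).det| ∂μ := by gcongr
      _ ≤ κ * ∫⁻ z in S, ENNReal.ofReal C * ENNReal.ofReal (√(Q z.1).det) ∂μ := by
          refine mul_le_mul_right ?_ _
          exact setLIntegral_mono' hS hb
      _ ≤ κ * ∫⁻ z in D ×ˢ Metric.closedBall 0 β,
            ENNReal.ofReal C * ENNReal.ofReal (√(Q z.1).det) ∂μ := by
          refine mul_le_mul_right ?_ _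
          exact lintegral_mono_set inter_subset_left
      _ = κ * (ENNReal.ofReal C * ((∫⁻ y in D, ENNReal.ofReal (√(Q y).det)) *
            volume (Metric.closedBall (0 : EuclideanSpace ℝ (Fin k)) β))) := by
          rw [lintegral_const_mul' _ _ ENNReal.ofReal_ne_top, ← Measure.prod_restrict]
          have := lintegral_prod_mul hQm
            (aemeasurable_const (b := (1 : ℝ≥0∞)) (μ := volume.restrict
              (Metric.closedBall (0 : EuclideanSpace ℝ (Fin k)) β)))
          simp only [mul_one, lintegral_const, Measure.restrict_apply_univ, one_mul] at this
          rw [this]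
      _ = _ := by
          rw [ENNReal.coe_mul, ENNReal.coe_mul, ENNReal.coe_toNNReal measure_closedBall_lt_top.ne,
            ENNReal.ofReal]
          ring

end LocalCrofton

/-! ### Immersions have injective derivative -/

section Immersion

variable {l n : ℕ}
  {L : Type*} [TopologicalSpace L] [ChartedSpace (EuclideanSpace ℝ (Fin l)) L]
  {M : Type*} [TopologicalSpace M] [ChartedSpace (EuclideanSpace ℝ (Fin n)) M]

/-- In the normal form of an immersion, projecting away the complement gives a local left inverse
`b`, differentiable at `f x`; the chain rule for `b ∘ f = id` concludes. -/
lemma mfderiv_injective_of_isImmersionAt {f : L → M} {x : L}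
    (h : IsImmersionAt (𝓡 l) (𝓡 n) ∞ f x) :
    Function.Injective (mfderiv (𝓡 l) (𝓡 n) f x) := by
  let φ := h.domChart.extend (𝓡 l)
  let κ := h.codChart.extend (𝓡 n)
  let P : EuclideanSpace ℝ (Fin n) →L[ℝ] EuclideanSpace ℝ (Fin l) :=
    (ContinuousLinearMap.fst ℝ _ h.complement).comp
      (h.equiv.symm : EuclideanSpace ℝ (Fin n) →L[ℝ] _)
  let b : M → L := fun z ↦ φ.symm (P (κ z))
  have hloc : ∀ y ∈ h.domChart.source, P (κ (f y)) = φ y := by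
    intro y hy
    have hy' : y ∈ φ.source := by rwa [OpenPartialHomeomorph.extend_source]
    have := h.writtenInCharts (φ.map_source hy')
    simp only [Function.comp_apply] at this
    have h2 : κ (f y) = h.equiv (φ y, 0) := by
      rw [← this]
      change κ (f y) = κ (f (φ.symm (φ y)))
      rw [φ.left_inv hy']
    rw [h2]
    simp [P]
  have hbf : b ∘ f =ᶠ[𝓝 x] id := by
    filter_upwards [h.domChart.open_source.mem_nhds h.mem_domChart_source] with y hy
    have hy' : y ∈ φ.source := by rwa [OpenPartialHomeomorph.extend_source]
    change φ.symm (P (κ (f y))) = y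
    rw [hloc y hy, φ.left_inv hy']
  have hκ : MDifferentiableAt (𝓡 n) 𝓘(ℝ, EuclideanSpace ℝ (Fin n)) κ (f x) :=
    (h.codChart.contMDiffAt_extend h.codChart_mem_maximalAtlas
      h.mem_codChart_source).mdifferentiableAt (by simp)
  have hφ : MDifferentiableAt 𝓘(ℝ, EuclideanSpace ℝ (Fin l)) (𝓡 l) φ.symm (P (κ (f x))) := by
    rw [hloc x h.mem_domChart_source]
    have h1 := (contMDiffOn_extend_symm h.domChart_mem_maximalAtlas)
    refine (h1.contMDiffAt ?_).mdifferentiableAt (by simp)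
    have : IsOpen ((𝓡 l) '' h.domChart.target) := by
      simpa using h.domChart.open_target
    exact this.mem_nhds ⟨_, h.domChart.map_source h.mem_domChart_source, rfl⟩
  have hP : MDifferentiableAt 𝓘(ℝ, EuclideanSpace ℝ (Fin n)) 𝓘(ℝ, EuclideanSpace ℝ (Fin l))
      P (κ (f x)) := P.differentiableAt.mdifferentiableAt
  have hb : MDifferentiableAt (𝓡 n) (𝓡 l) b (f x) := hφ.comp (f x) (hP.comp (f x) hκ)
  have hf : MDifferentiableAt (𝓡 l) (𝓡 n) f x := h.contMDiffAt.mdifferentiableAt (by simp)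
  have hid := hbf.mfderiv_eq (I := 𝓡 l) (I' := 𝓡 l)
  rw [mfderiv_comp x hb hf, mfderiv_id] at hid
  intro v w hvw
  have h1 := congrArg (mfderiv (𝓡 n) (𝓡 l) b (f x)) hvw
  have h2 := DFunLike.congr_fun hid v
  have h3 := DFunLike.congr_fun hid w
  exact h2.symm.trans (h1.trans h3)

end Immersion

/-! ### The Gram matrix of the induced metric -/

section Metric

open Bundle

variable {n m : ℕ}
  {M : Type*} [TopologicalSpace M] [ChartedSpace (EuclideanSpace ℝ (Fin n)) M]
  {N : Type*} [TopologicalSpace N] [ChartedSpace (EuclideanSpace ℝ (Fin m)) N]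

lemma contMDiffOn_comp_extChartAt_symm [IsManifold (𝓡 m) ∞ N] {f : N → M} (hf : ContMDiff (𝓡 m) (𝓡 n) ∞ f) (p : N) :
    ContMDiffOn 𝓘(ℝ, EuclideanSpace ℝ (Fin m)) (𝓡 n) ∞
      (fun z ↦ f ((extChartAt (𝓡 m) p).symm z)) (extChartAt (𝓡 m) p).target :=
  hf.comp_contMDiffOn (contMDiffOn_extChartAt_symm p)

lemma mfderiv_toLp_eq_sum (f : N → M) (p : N) (y : EuclideanSpace ℝ (Fin m)) (v : Fin m → ℝ) :
    mfderiv 𝓘(ℝ, EuclideanSpace ℝ (Fin m)) (𝓡 n) (fun z ↦ f ((extChartAt (𝓡 m) p).symm z)) y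
      (WithLp.toLp 2 v) = ∑ i, v i • coordVector f p y i := by
  have hv : (WithLp.toLp 2 v : EuclideanSpace ℝ (Fin m)) =
      ∑ i, v i • EuclideanSpace.single i (1 : ℝ) := by
    ext j
    simp [Finset.sum_apply, Pi.single_apply]
  let T : EuclideanSpace ℝ (Fin m) →L[ℝ] TangentSpace (𝓡 n) (f ((extChartAt (𝓡 m) p).symm y)) :=
    mfderiv 𝓘(ℝ, EuclideanSpace ℝ (Fin m)) (𝓡 n) (fun z ↦ f ((extChartAt (𝓡 m) p).symm z)) y
  change T (WithLp.toLp 2 v) = ∑ i, v i • T (EuclideanSpace.single i (1 : ℝ))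
  rw [hv, map_sum]
  simp only [map_smul]

variable [IsManifold (𝓡 n) ∞ M]
  (g : Bundle.ContMDiffRiemannianMetric (𝓡 n) ∞ (EuclideanSpace ℝ (Fin n))
    (fun x : M ↦ TangentSpace (𝓡 n) x))

attribute [local instance] normedAddCommGroupTangentSpaceVectorSpace
  normedSpaceTangentSpaceVectorSpace in
/-- Near a point, the metric dominates the Euclidean metric of the chart. -/
lemma exists_norm_mfderiv_extChartAt_sq_le (z₀ : M) :
    ∃ c : ℝ, ∀ᶠ z in 𝓝 z₀, ∀ w : TangentSpace (𝓡 n) z,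
      ‖(mfderiv (𝓡 n) 𝓘(ℝ, EuclideanSpace ℝ (Fin n)) (extChartAt (𝓡 n) z₀) z w :
        EuclideanSpace ℝ (Fin n))‖ ^ 2 ≤ c ^ 2 * g.inner z w w := by
  let : RiemannianBundle (fun x : M ↦ TangentSpace (𝓡 n) x) := ⟨g.toRiemannianMetric⟩
  have : IsContinuousRiemannianBundle (EuclideanSpace ℝ (Fin n))
      (fun x : M ↦ TangentSpace (𝓡 n) x) :=
    ⟨⟨g.inner, g.contMDiff.continuous, fun _ _ _ ↦ rfl⟩⟩
  have : IsManifold (𝓡 n) 1 M := IsManifold.of_le (n := ∞) (by simp)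
  obtain ⟨c, hc, h⟩ := eventually_norm_mfderiv_extChartAt_lt (𝓡 n) z₀
  refine ⟨c, ?_⟩
  filter_upwards [h] with z hz w
  have h1 := (mfderiv (𝓡 n) 𝓘(ℝ, EuclideanSpace ℝ (Fin n))
    (extChartAt (𝓡 n) z₀) z).le_of_opNorm_le hz.le w
  have h2 : g.inner z w w = ‖w‖ ^ 2 := (real_inner_self_eq_norm_sq w)
  rw [h2, ← mul_pow]
  exact pow_le_pow_left₀ (norm_nonneg _) h1 2

lemma dotProduct_gramMatrix_mulVec (f : N → M) (p : N) (y : EuclideanSpace ℝ (Fin m))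
    (v : Fin m → ℝ) :
    v ⬝ᵥ (gramMatrix g f p y).mulVec v =
      g.inner (f ((extChartAt (𝓡 m) p).symm y)) (∑ i, v i • coordVector f p y i)
        (∑ i, v i • coordVector f p y i) := by
  simp only [map_sum, map_smul, sum_apply, smul_apply,
    dotProduct, Matrix.mulVec, gramMatrix, Matrix.of_apply, Finset.mul_sum, smul_eq_mul]
  rw [Finset.sum_comm]
  refine Finset.sum_congr rfl fun i _ ↦ Finset.sum_congr rfl fun j _ ↦ by ring

lemma posSemidef_gramMatrix (f : N → M) (p : N) (y : EuclideanSpace ℝ (Fin m)) :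
    (gramMatrix g f p y).PosSemidef := by
  refine Matrix.PosSemidef.of_dotProduct_mulVec_nonneg ?_ fun v ↦ ?_
  · ext i j
    exact g.symm _ _ _
  · rw [star_trivial, dotProduct_gramMatrix_mulVec]
    set w := ∑ i, v i • coordVector (n := n) f p y i
    by_cases hw : w = 0
    · rw [hw, map_zero]
    · exact (g.pos _ w hw).le

/-- The coordinate fields are images of constant fields under the tangent map, hence continuous into
the tangent bundle, and the metric is continuous there. -/
lemma continuousOn_gramMatrix [IsManifold (𝓡 m) ∞ N] {f : N → M} (hf : ContMDiff (𝓡 m) (𝓡 n) ∞ f) (p : N) :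
    ContinuousOn (gramMatrix g f p) (extChartAt (𝓡 m) p).target := by
  let : RiemannianBundle (fun x : M ↦ TangentSpace (𝓡 n) x) := ⟨g.toRiemannianMetric⟩
  have : IsContinuousRiemannianBundle (EuclideanSpace ℝ (Fin n))
      (fun x : M ↦ TangentSpace (𝓡 n) x) :=
    ⟨⟨g.inner, g.contMDiff.continuous, fun _ _ _ ↦ rfl⟩⟩
  have ho := isOpen_extChartAt_target (I := 𝓡 m) p
  have h1 := (contMDiffOn_comp_extChartAt_symm hf p).continuousOn_tangentMapWithin (by simp)
    ho.uniqueMDiffOn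
  have h2 : ∀ i : Fin m, ContinuousOn (fun y ↦ (⟨f ((extChartAt (𝓡 m) p).symm y),
      coordVector f p y i⟩ : TotalSpace (EuclideanSpace ℝ (Fin n))
        (fun x : M ↦ TangentSpace (𝓡 n) x))) (extChartAt (𝓡 m) p).target := by
    intro i
    have h3 : Continuous (fun y : EuclideanSpace ℝ (Fin m) ↦
        (⟨y, EuclideanSpace.single i (1 : ℝ)⟩ : TangentBundle 𝓘(ℝ, EuclideanSpace ℝ (Fin m))
          (EuclideanSpace ℝ (Fin m)))) := by
      have := (tangentBundleModelSpaceHomeomorph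
        𝓘(ℝ, EuclideanSpace ℝ (Fin m))).symm.continuous.comp
        (Continuous.prodMk_left (X := EuclideanSpace ℝ (Fin m))
          (EuclideanSpace.single i (1 : ℝ)))
      exact this
    refine (h1.comp h3.continuousOn (fun y hy ↦ hy)).congr fun y hy ↦ ?_
    simp only [Function.comp_apply, tangentMapWithin, mfderivWithin_of_isOpen ho hy]
    rfl
  refine continuousOn_pi.2 fun i ↦ continuousOn_pi.2 fun j ↦ ?_
  exact (h2 i).inner_bundle (h2 j)

end Metric

lemma measurableSet_inter_preimage_of_continuousOn {X Y : Type*} [TopologicalSpace X]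
    [MeasurableSpace X] [OpensMeasurableSpace X] [TopologicalSpace Y] [MeasurableSpace Y]
    [BorelSpace Y] {f : X → Y} {S : Set X} (hS : MeasurableSet S) (hf : ContinuousOn f S)
    {A : Set Y} (hA : MeasurableSet A) : MeasurableSet (S ∩ f ⁻¹' A) := by
  have h1 : Measurable (S.domRestrict f) := (continuousOn_iff_continuous_domRestrict.1 hf).measurable
  have h2 := hS.subtype_image (h1 hA)
  convert! h2 using 1
  ext x
  simp [Set.domRestrict, and_comm]

/-! ### Passing from Lebesgue measure to a smooth measure -/

section SmoothMeasure

variable {d : ℕ} {H : Type*} [TopologicalSpace H]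
  (I : ModelWithCorners ℝ (EuclideanSpace ℝ (Fin d)) H)
  {X : Type*} [TopologicalSpace X] [ChartedSpace H X]
  [MeasurableSpace X] [BorelSpace X]

lemma aemeasurable_extChartAt_symm (p : X) (ν : Measure (EuclideanSpace ℝ (Fin d)))
    (hν : ν ≪ volume.restrict (extChartAt I p).target) :
    AEMeasurable (extChartAt I p).symm ν :=
  ((continuousOn_extChartAt_symm p).aemeasurable
    (measurableSet_extChartAt_target I p)).mono_ac hν

/-- A smooth measure is locally dominated by the Lebesgue measure of a chart, and ignores the
boundary. -/
lemma IsSmoothMeasure.exists_nhds_lintegral_le {μ : Measure X} (hμ : IsSmoothMeasure I μ)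
    (p : X) : ∃ K : NNReal, ∃ U ∈ 𝓝 p, ∀ V ⊆ U, IsOpen V → V ⊆ (extChartAt I p).source →
      ∀ h : EuclideanSpace ℝ (Fin d) → ℝ≥0∞, Measurable h →
      ∃ h' : X → ℝ≥0∞, Measurable h' ∧
        (∀ s ∈ V, extChartAt I p s ∈ interior (range I) → h (extChartAt I p s) ≤ h' s) ∧
        (∀ s ∈ V, extChartAt I p s ∉ interior (range I) → h' s = ⊤) ∧
        ∫⁻ s, h' s ∂μ ≤ K * ∫⁻ y, h y := by
  classical
  obtain ⟨ρ, hρs, -, hρ⟩ := hμ p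
  set φ := extChartAt I p with hφ
  have hsrc : IsOpen φ.source := isOpen_extChartAt_source p
  have hcont : ContinuousAt (fun s ↦ ρ (φ s)) p := by
    have h1 : ContinuousOn (ρ ∘ φ) φ.source :=
      hρs.continuousOn.comp (continuousOn_extChartAt p) fun s hs ↦ φ.map_source hs
    exact h1.continuousAt (extChartAt_source_mem_nhds p)
  have hbd : ∀ᶠ s in 𝓝 p, ρ (φ s) < ρ (φ p) + 1 :=
    hcont.eventually_lt continuousAt_const (by simp)
  refine ⟨(ρ (φ p) + 1).toNNReal, _, hbd, fun V hVU hV hVs h hm ↦ ?_⟩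
  -- The value `⊤` makes any bound on the boundary trivial. It does not change the integral over the
  -- chart target, because the frontier of the convex set `range I` is Lebesgue null.
  let k : EuclideanSpace ℝ (Fin d) → ℝ≥0∞ := fun y ↦
    if y ∈ interior (range I) then h y else ⊤
  have hk : Measurable k := hm.ite isOpen_interior.measurableSet measurable_const
  have hφV : ContinuousOn φ V := (continuousOn_extChartAt p).mono hVs
  let h' : X → ℝ≥0∞ := V.indicator (fun s ↦ k (φ s))
  have hh' : Measurable h' := by
    have h1 : Measurable (V.piecewise φ (fun _ ↦ 0)) :=
      hφV.measurable_piecewise continuousOn_const hV.measurableSet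
    have h2 : h' = V.indicator (k ∘ V.piecewise φ (fun _ ↦ 0)) := by
      ext s
      by_cases hs : s ∈ V <;> simp [h', hs]
    rw [h2]
    exact (hk.comp h1).indicator hV.measurableSet
  refine ⟨h', hh', fun s hs hi ↦ ?_, fun s hs hi ↦ ?_, ?_⟩
  · simp [h', hs, k, hi]
  · simp [h', hs, k, hi]
  have hT : MeasurableSet φ.target := measurableSet_extChartAt_target I p
  have hρm : AEMeasurable (fun y ↦ ENNReal.ofReal (ρ y)) (volume.restrict φ.target) :=
    (hρs.continuousOn.aemeasurable hT).ennreal_ofReal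
  have hsm := aemeasurable_extChartAt_symm I p _ Measure.AbsolutelyContinuous.rfl
  have hkh : ∫⁻ y in φ.target, k y ≤ ∫⁻ y, h y := by
    have h0 : volume (frontier (range I)) = 0 := I.convex_range.addHaar_frontier volume
    have h1 : ∀ᵐ y, y ∉ frontier (range I) := measure_eq_zero_iff_ae_notMem.1 h0
    refine le_trans ?_ (setLIntegral_le_lintegral φ.target h)
    refine setLIntegral_mono_ae' hT ?_
    filter_upwards [h1] with y hy hyT
    have hyI : y ∈ range I := extChartAt_target_subset_range p hyT
    have : y ∈ interior (range I) := by
      by_contra hcon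
      exact hy ⟨subset_closure hyI, hcon⟩
    simp [k, this]
  calc ∫⁻ s, h' s ∂μ = ∫⁻ s in φ.source, h' s ∂μ := by
        rw [setLIntegral_eq_of_support_subset]
        intro s hs
        by_contra hcon
        exact hs (indicator_of_notMem (fun hsV ↦ hcon (hVs hsV)) _)
    _ = ∫⁻ y, h' (φ.symm y) ∂((volume.restrict φ.target).withDensity
          fun y ↦ ENNReal.ofReal (ρ y)) := by
        rw [hρ, chartMeasure, lintegral_map' hh'.aemeasurable
          (aemeasurable_extChartAt_symm I p _ (withDensity_absolutelyContinuous _ _))]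
    _ = ∫⁻ y in φ.target, ENNReal.ofReal (ρ y) * h' (φ.symm y) :=
        lintegral_withDensity_eq_lintegral_mul₀ hρm (hh'.comp_aemeasurable hsm)
    _ ≤ ∫⁻ y in φ.target, ((ρ (φ p) + 1).toNNReal : ℝ≥0∞) * k y := by
        refine setLIntegral_mono' hT fun y hy ↦ ?_
        by_cases hyV : φ.symm y ∈ V
        · have h1 := hVU hyV
          simp only [mem_ofPred_eq, φ.right_inv hy] at h1
          have h2 : h' (φ.symm y) = k y := by
            simp only [h', indicator_of_mem hyV, φ.right_inv hy]
          rw [h2]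
          exact mul_le_mul_left (ENNReal.ofReal_le_ofReal h1.le) _
        · simp [h', indicator_of_notMem hyV]
    _ = ((ρ (φ p) + 1).toNNReal : ℝ≥0∞) * ∫⁻ y in φ.target, k y := lintegral_const_mul _ hk
    _ ≤ _ := mul_le_mul_right hkh _

end SmoothMeasure

/-! ### The estimate near a point of $B\times L$ -/

section LocalManifold

variable {d l m n : ℕ}
  {HB : Type*} [TopologicalSpace HB]
  {IB : ModelWithCorners ℝ (EuclideanSpace ℝ (Fin d)) HB}
  {B : Type*} [TopologicalSpace B] [ChartedSpace HB B]
  {L : Type*} [TopologicalSpace L] [ChartedSpace (EuclideanSpace ℝ (Fin l)) L]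
  {M : Type u} [TopologicalSpace M] [ChartedSpace (EuclideanSpace ℝ (Fin n)) M]

/-- By the chain rule along `y ↦ (s, y)`, the derivative of $\Psi_s$ is that of $\Psi$ on vectors
`(0, w)`. This supplies the injectivity needed for the linear completion. -/
lemma eq_zero_of_mfderiv_prod_eq_zero {Ψ : B × L → M}
    (hΨ : ContMDiff (IB.prod (𝓡 l)) (𝓡 n) ∞ Ψ) {s : B} {x : L}
    (hs : Function.Injective (mfderiv (𝓡 l) (𝓡 n) (fun x ↦ Ψ (s, x)) x))
    {w : EuclideanSpace ℝ (Fin l)}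
    (hw : (mfderiv (IB.prod (𝓡 l)) (𝓡 n) Ψ (s, x) :
      EuclideanSpace ℝ (Fin d) × EuclideanSpace ℝ (Fin l) →L[ℝ] EuclideanSpace ℝ (Fin n))
        (0, w) = 0) : w = 0 := by
  have h1 : MDifferentiableAt (IB.prod (𝓡 l)) (𝓡 n) Ψ (s, x) :=
    hΨ.mdifferentiableAt (by simp)
  have h2 : MDifferentiableAt (𝓡 l) (IB.prod (𝓡 l)) (fun y : L ↦ (s, y)) x :=
    mdifferentiableAt_const.prodMk mdifferentiableAt_id
  have h3 : mfderiv (𝓡 l) (𝓡 n) (fun x ↦ Ψ (s, x)) x = _ := mfderiv_comp x h1 h2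
  rw [mfderiv_prod_right] at h3
  have h4 : mfderiv (𝓡 l) (𝓡 n) (fun x ↦ Ψ (s, x)) x w = 0 := by
    rw [h3]
    exact hw
  exact hs (h4.trans (map_zero (mfderiv (𝓡 l) (𝓡 n) (fun x ↦ Ψ (s, x)) x)).symm)

variable [IsManifold (𝓡 n) ∞ M]
  [MeasurableSpace B] [BorelSpace B]
  (g : Bundle.ContMDiffRiemannianMetric (𝓡 n) ∞ (EuclideanSpace ℝ (Fin n))
    (fun x : M ↦ TangentSpace (𝓡 n) x))

/-- Crofton's inequality for a small piece of each of the manifolds. -/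
lemma exists_nhds_crofton (hdim : m + l = n) {ds : Measure B} (hds : IsSmoothMeasure IB ds)
    {Ψ : B × L → M} (hΨ : ContMDiff (IB.prod (𝓡 l)) (𝓡 n) ∞ Ψ) (s₀ : B) (x₀ : L)
    (hsub : Function.Surjective (mfderiv (IB.prod (𝓡 l)) (𝓡 n) Ψ (s₀, x₀)))
    (himm : Function.Injective (mfderiv (𝓡 l) (𝓡 n) (fun x ↦ Ψ (s₀, x)) x₀)) :
    ∃ E ∈ 𝓝 (s₀, x₀), ∃ C : NNReal,
      ∀ (N : Type u) [TopologicalSpace N] [ChartedSpace (EuclideanSpace ℝ (Fin m)) N]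
        [IsManifold (𝓡 m) ∞ N] [MeasurableSpace N] [BorelSpace N]
        (ι : N → M), ContMDiff (𝓡 m) (𝓡 n) ∞ ι → ∀ (p : N) (A : Set N), MeasurableSet A →
        A ⊆ (extChartAt (𝓡 m) p).source →
        ∃ h : B → ℝ≥0∞, Measurable h ∧
          (∀ s, ({z | (∃ x, (s, x) ∈ E ∧ Ψ (s, x) = z) ∧ z ∈ ι '' A}.encard : ℝ≥0∞) ≤ h s) ∧
          ∫⁻ s, h s ∂ds ≤ C * chartMeasure (𝓡 m) p
            (fun y ↦ ENNReal.ofReal (√(gramMatrix g ι p y).det)) A := by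
  set φB := extChartAt IB s₀
  set φL := extChartAt (𝓡 l) x₀
  set φM := extChartAt (𝓡 n) (Ψ (s₀, x₀))
  let ψ : EuclideanSpace ℝ (Fin d) × EuclideanSpace ℝ (Fin l) → EuclideanSpace ℝ (Fin n) :=
    fun v ↦ φM (Ψ (φB.symm v.1, φL.symm v.2))
  have hψeq : φM ∘ Ψ ∘ (extChartAt (IB.prod (𝓡 l)) (s₀, x₀)).symm = ψ := by
    rw [extChartAt_prod]
    rfl
  have hpt : extChartAt (IB.prod (𝓡 l)) (s₀, x₀) (s₀, x₀) = (φB s₀, φL x₀) := by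
    rw [extChartAt_prod]
    rfl
  have hrange : range (IB.prod (𝓡 l)) = range IB ×ˢ univ := by
    rw [modelWithCorners_prod_coe, range_prodMap]
    simp
  have hψ : ContDiffWithinAt ℝ 1 ψ (range IB ×ˢ univ) (φB s₀, φL x₀) := by
    have := (contMDiffAt_iff.1 (hΨ.contMDiffAt (x := (s₀, x₀)))).2
    rw [hψeq, hpt, hrange] at this
    exact this.of_le (by simp)
  have hA : HasFDerivWithinAt ψ (mfderiv (IB.prod (𝓡 l)) (𝓡 n) Ψ (s₀, x₀) :
      EuclideanSpace ℝ (Fin d) × EuclideanSpace ℝ (Fin l) →L[ℝ] EuclideanSpace ℝ (Fin n))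
      (range IB ×ˢ univ) (φB s₀, φL x₀) := by
    have := (hΨ.mdifferentiableAt (x := (s₀, x₀)) (by simp)).hasMFDerivAt.2
    have h2 : writtenInExtChartAt (IB.prod (𝓡 l)) (𝓡 n) (s₀, x₀) Ψ = ψ := hψeq
    rw [h2, hpt, hrange] at this
    exact this
  obtain ⟨c, hc⟩ := exists_norm_mfderiv_extChartAt_sq_le g (Ψ (s₀, x₀))
  obtain ⟨M₀, hM₀, hM₀o, hzM₀⟩ := eventually_nhds_iff.1 (hc.and
    (extChartAt_source_mem_nhds (I := 𝓡 n) (Ψ (s₀, x₀))))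
  obtain ⟨r, hr, C, hC⟩ := exists_local_crofton (m := m)
    (by simpa using hdim) IB.convex_range IB.nonempty_interior
    (mem_range_self _) (φL x₀) hψ hA hsub
    (fun w hw ↦ eq_zero_of_mfderiv_prod_eq_zero hΨ himm hw) c
  obtain ⟨K, U, hU, hK⟩ := IsSmoothMeasure.exists_nhds_lintegral_le IB hds s₀
  have hB : φB.source ∩ φB ⁻¹' Metric.ball (φB s₀) r ∈ 𝓝 s₀ :=
    Filter.inter_mem (extChartAt_source_mem_nhds s₀)
      ((continuousAt_extChartAt s₀).preimage_mem_nhds (Metric.ball_mem_nhds _ hr))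
  have hL : φL.source ∩ φL ⁻¹' Metric.ball (φL x₀) r ∈ 𝓝 x₀ :=
    Filter.inter_mem (extChartAt_source_mem_nhds x₀)
      ((continuousAt_extChartAt x₀).preimage_mem_nhds (Metric.ball_mem_nhds _ hr))
  obtain ⟨V, hVsub, hVo, hsV⟩ := mem_nhds_iff.1 (Filter.inter_mem hU hB)
  refine ⟨V ×ˢ (φL.source ∩ φL ⁻¹' Metric.ball (φL x₀) r) ∩ Ψ ⁻¹' M₀,
    Filter.inter_mem (prod_mem_nhds (hVo.mem_nhds hsV) hL)
      (hΨ.continuous.continuousAt.preimage_mem_nhds (hM₀o.mem_nhds hzM₀)), K * C, ?_⟩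
  intro N _ _ _ _ _ ι hι p A hAm hAp
  set φN := extChartAt (𝓡 m) p
  -- On `M₀` the metric dominates the chart metric. No intersection point is lost, as those counted
  -- lie in `Ψ '' E`, which is inside `M₀`.
  let A' : Set N := A ∩ ι ⁻¹' M₀
  have hA'm : MeasurableSet A' := hAm.inter (hM₀o.preimage hι.continuous).measurableSet
  have hA'p : A' ⊆ φN.source := inter_subset_left.trans hAp
  let D : Set (EuclideanSpace ℝ (Fin m)) := φN '' A'
  have hDt : D ⊆ φN.target := by
    rintro _ ⟨y, hy, rfl⟩
    exact φN.map_source (hA'p hy)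
  have hDM : ∀ y ∈ D, ι (φN.symm y) ∈ M₀ := by
    rintro _ ⟨y, hy, rfl⟩
    rw [φN.left_inv (hA'p hy)]
    exact hy.2
  have hDm : MeasurableSet D := by
    have : D = φN.target ∩ φN.symm ⁻¹' A' := φN.image_eq_target_inter_inv_preimage hA'p
    rw [this]
    exact measurableSet_inter_preimage_of_continuousOn (measurableSet_extChartAt_target _ p)
      (continuousOn_extChartAt_symm p) hA'm
  let J : EuclideanSpace ℝ (Fin m) → EuclideanSpace ℝ (Fin n) := fun y ↦ φM (ι (φN.symm y))
  let J' : EuclideanSpace ℝ (Fin m) → EuclideanSpace ℝ (Fin m) →L[ℝ] EuclideanSpace ℝ (Fin n) :=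
    fun y ↦ ContinuousLinearMap.comp
      (mfderiv (𝓡 n) 𝓘(ℝ, EuclideanSpace ℝ (Fin n)) φM (ι (φN.symm y)))
      (mfderiv 𝓘(ℝ, EuclideanSpace ℝ (Fin m)) (𝓡 n) (fun z ↦ ι (φN.symm z)) y)
  have hJ : ∀ y ∈ D, HasFDerivAt J (J' y) y := by
    intro y hy
    have h1 : MDifferentiableAt 𝓘(ℝ, EuclideanSpace ℝ (Fin m)) (𝓡 n)
        (fun z ↦ ι (φN.symm z)) y :=
      ((contMDiffOn_comp_extChartAt_symm hι p).contMDiffAt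
        ((isOpen_extChartAt_target p).mem_nhds (hDt hy))).mdifferentiableAt (by simp)
    have h2 : MDifferentiableAt (𝓡 n) 𝓘(ℝ, EuclideanSpace ℝ (Fin n)) φM (ι (φN.symm y)) := by
      refine mdifferentiableAt_extChartAt ?_
      rw [← extChartAt_source (𝓡 n)]
      exact (hM₀ _ (hDM y hy)).2
    exact (h2.hasMFDerivAt.comp y h1.hasMFDerivAt).hasFDerivAt
  have hgc : ContinuousOn (fun y ↦ ENNReal.ofReal (√(gramMatrix g ι p y).det)) D := by
    refine ENNReal.continuous_ofReal.comp_continuousOn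
      (Real.continuous_sqrt.comp_continuousOn ?_)
    exact (Continuous.matrix_det continuous_id).comp_continuousOn
      ((continuousOn_gramMatrix g hι p).mono hDt)
  obtain ⟨h, hm, hle, hint⟩ := hC D J J' (gramMatrix g ι p) hDm hJ
    (fun y _ ↦ posSemidef_gramMatrix g ι p y)
    (fun y hy v ↦ by
      rw [dotProduct_gramMatrix_mulVec, ← mfderiv_toLp_eq_sum]
      exact (hM₀ _ (hDM y hy)).1 _)
    (hgc.aemeasurable hDm)
  obtain ⟨h', hm', hle', htop, hint'⟩ := hK V (hVsub.trans inter_subset_left) hVo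
    (hVsub.trans (inter_subset_right.trans inter_subset_left)) h hm
  refine ⟨h', hm', fun s ↦ ?_, ?_⟩
  · by_cases hsV : s ∈ V
    · by_cases hsi : φB s ∈ interior (range IB)
      · refine le_trans ?_ (hle' s hsV hsi)
        have hsB := (hVsub hsV).2
        refine le_trans ?_ (hle (φB s) ⟨hsB.2, hsi⟩)
        rw [ENat.toENNReal_le]
        refine le_trans (encard_le_encard ?_) (encard_image_le (fun y ↦ ι (φN.symm y)) _)
        rintro z ⟨⟨x, hx, rfl⟩, y, hy, hyz⟩
        have hyA : y ∈ A' := ⟨hy, by change ι y ∈ M₀; rw [hyz]; exact hx.2⟩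
        have hinv : φN.symm (φN y) = y := φN.left_inv (hA'p hyA)
        refine ⟨φN y, ⟨⟨y, hyA, rfl⟩, φL x, hx.1.2.2, ?_⟩, ?_⟩
        · change φM (Ψ (φB.symm (φB s), φL.symm (φL x))) = φM (ι (φN.symm (φN y)))
          rw [φB.left_inv hsB.1, φL.left_inv hx.1.2.1, hinv, hyz]
        · change ι (φN.symm (φN y)) = _
          rw [hinv, hyz]
      · rw [htop s hsV hsi]
        exact le_top
    · have : {z | (∃ x, (s, x) ∈ V ×ˢ (φL.source ∩ φL ⁻¹' Metric.ball (φL x₀) r) ∩ Ψ ⁻¹' M₀ ∧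
          Ψ (s, x) = z) ∧ z ∈ ι '' A} = ∅ := by
        refine eq_empty_of_forall_notMem ?_
        rintro z ⟨⟨x, hx, -⟩, -⟩
        exact hsV hx.1.1
      rw [this]
      simp
  · calc _ ≤ K * ∫⁻ y, h y := hint'
      _ ≤ K * (C * ∫⁻ y in D, ENNReal.ofReal (√(gramMatrix g ι p y).det)) :=
          mul_le_mul_right hint _
      _ = (K * C : NNReal) * chartMeasure (𝓡 m) p
            (fun y ↦ ENNReal.ofReal (√(gramMatrix g ι p y).det)) A' := by
          rw [chartMeasure_apply (𝓡 m) p _ hA'm hA'p, ENNReal.coe_mul, mul_assoc]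
      _ ≤ _ := mul_le_mul_right (measure_mono inter_subset_left) _

end LocalManifold

/-! ### Measurability of the number of intersection points -/

section Counting

variable {B L M : Type*} [TopologicalSpace B] [CompactSpace B] [T2Space B] [MeasurableSpace B]
  [BorelSpace B] [TopologicalSpace L] [CompactSpace L] [MetricSpace M]

/-- Having `k` points in `K` at mutual distance at least `1 / (r + 1)` is a closed condition on
$B\times L^k$. Its projection to $B$ is compact, and the union over `r` gives all `k`-tuples of
distinct points. -/
lemma measurableSet_le_encard_inter {Ψ : B × L → M} (hΨ : Continuous Ψ) {K : Set M}
    (hK : IsClosed K) (k : ℕ) :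
    MeasurableSet {s | (k : ℕ∞) ≤ (range (fun x ↦ Ψ (s, x)) ∩ K).encard} := by
  let Q : ℕ → Set (B × (Fin k → L)) := fun r ↦ {v | (∀ i, Ψ (v.1, v.2 i) ∈ K) ∧
    ∀ i j, i ≠ j → 1 / ((r : ℝ) + 1) ≤ dist (Ψ (v.1, v.2 i)) (Ψ (v.1, v.2 j))}
  have hc : ∀ i, Continuous fun v : B × (Fin k → L) ↦ Ψ (v.1, v.2 i) := fun i ↦
    hΨ.comp (continuous_fst.prodMk ((continuous_apply i).comp continuous_snd))
  have hQ : ∀ r, IsClosed (Q r) := by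
    intro r
    refine IsClosed.inter (s₁ := {v : B × (Fin k → L) | ∀ i, Ψ (v.1, v.2 i) ∈ K})
      (s₂ := {v : B × (Fin k → L) | ∀ i j, i ≠ j →
        1 / ((r : ℝ) + 1) ≤ dist (Ψ (v.1, v.2 i)) (Ψ (v.1, v.2 j))}) ?_ ?_
    · simp only [ofPred_forall]
      exact isClosed_iInter fun i ↦ hK.preimage (hc i)
    · simp only [ofPred_forall]
      exact isClosed_iInter fun i ↦ isClosed_iInter fun j ↦ isClosed_iInter fun _ ↦
        isClosed_le continuous_const ((hc i).dist (hc j))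
  have heq : {s | (k : ℕ∞) ≤ (range (fun x ↦ Ψ (s, x)) ∩ K).encard} =
      ⋃ r, Prod.fst '' Q r := by
    ext s
    simp only [mem_ofPred_eq, mem_iUnion]
    constructor
    · intro h
      obtain ⟨t, ht, htk⟩ := exists_subset_encard_eq h
      have htf : t.Finite := finite_of_encard_eq_coe htk
      obtain ⟨f, hf, hft⟩ : ∃ f : Fin k → M, Function.Injective f ∧ ∀ i, f i ∈ t := by
        have hcard : htf.toFinset.card = k := by
          rw [htf.encard_eq_coe_toFinset_card] at htk
          exact_mod_cast htk
        let e := (htf.toFinset.equivFinOfCardEq hcard).symm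
        exact ⟨fun i ↦ e i, Subtype.val_injective.comp e.injective,
          fun i ↦ htf.mem_toFinset.1 (e i).2⟩
      choose x hx using fun i ↦ (ht (hft i)).1
      have hr : ∃ r : ℕ, ∀ i j, i ≠ j → 1 / ((r : ℝ) + 1) ≤ dist (f i) (f j) := by
        have : ∀ ij : Fin k × Fin k, ∀ᶠ r : ℕ in Filter.atTop, ij.1 ≠ ij.2 →
            1 / ((r : ℝ) + 1) ≤ dist (f ij.1) (f ij.2) := by
          intro ij
          by_cases hij : ij.1 = ij.2
          · simp [hij]
          · have hpos : 0 < dist (f ij.1) (f ij.2) := dist_pos.2 (hf.ne hij)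
            filter_upwards [tendsto_one_div_add_atTop_nhds_zero_nat.eventually_le_const hpos]
              with r hr _ using hr
        obtain ⟨r, hr⟩ := (Filter.eventually_all.2 this).exists
        exact ⟨r, fun i j ↦ hr (i, j)⟩
      obtain ⟨r, hr⟩ := hr
      refine ⟨r, (s, x), ⟨fun i ↦ ?_, fun i j hij ↦ ?_⟩, rfl⟩
      · have := hx i
        simp only at this ⊢
        rw [this]
        exact (ht (hft i)).2
      · have h1 := hx i
        have h2 := hx j
        simp only at h1 h2 ⊢
        rw [h1, h2]
        exact hr i j hij
    · rintro ⟨r, ⟨s', x⟩, ⟨h1, h2⟩, rfl⟩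
      have hinj : Function.Injective fun i ↦ Ψ (s', x i) := by
        intro i j hij
        by_contra hne
        have h3 := h2 i j hne
        simp only at hij h3
        rw [hij, dist_self] at h3
        exact absurd h3 (not_le.2 (by positivity))
      have h3 : (range fun i ↦ Ψ (s', x i)).encard = k := by
        rw [← image_univ, hinj.encard_image, encard_univ]
        simp
      rw [← h3]
      refine encard_le_encard ?_
      rintro _ ⟨i, rfl⟩
      exact ⟨⟨x i, rfl⟩, h1 i⟩
  rw [heq]
  exact MeasurableSet.iUnion fun r ↦
    (((hQ r).isCompact.image continuous_fst).isClosed).measurableSet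

lemma measurable_encard_inter {Ψ : B × L → M} (hΨ : Continuous Ψ) {K : Set M}
    (hK : IsClosed K) :
    Measurable fun s ↦ ((range (fun x ↦ Ψ (s, x)) ∩ K).encard : ℝ≥0∞) := by
  classical
  have heq : (fun s ↦ ((range (fun x ↦ Ψ (s, x)) ∩ K).encard : ℝ≥0∞)) = fun s ↦ ⨆ k : ℕ,
      {s | (k : ℕ∞) ≤ (range (fun x ↦ Ψ (s, x)) ∩ K).encard}.indicator
        (fun _ ↦ (k : ℝ≥0∞)) s := by
    ext s
    refine le_antisymm (coe_encard_le_of_forall_finset fun Z hZ ↦ ?_) (iSup_le fun k ↦ ?_)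
    · refine le_iSup_of_le Z.card ?_
      rw [indicator_of_mem]
      rw [mem_ofPred_eq, ← encard_coe_eq_coe_finsetCard]
      exact encard_le_encard hZ
    · refine indicator_apply_le' (fun h ↦ ?_) fun _ ↦ bot_le
      have : ((k : ℕ∞) : ℝ≥0∞) ≤ ((range (fun x ↦ Ψ (s, x)) ∩ K).encard : ℝ≥0∞) :=
        ENat.toENNReal_le.2 h
      simpa using this
  rw [heq]
  exact Measurable.iSup fun k ↦
    measurable_const.indicator (measurableSet_le_encard_inter hΨ hK k)

end Counting

lemma encard_biUnion_le_sum {α β : Type*} (t : Finset α) (f : α → Set β) :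
    ((⋃ a ∈ t, f a).encard : ℝ≥0∞) ≤ ∑ a ∈ t, ((f a).encard : ℝ≥0∞) := by
  classical
  induction t using Finset.induction_on with
  | empty => simp
  | insert a t ha ih =>
    rw [Finset.set_biUnion_insert, Finset.sum_insert ha]
    refine le_trans (ENat.toENNReal_le.2 (encard_union_le _ _)) ?_
    rw [ENat.toENNReal_add]
    gcongr

/-! ### Cutting the submanifold into chart pieces -/

section Volume

variable {n m : ℕ}
  {M : Type*} [TopologicalSpace M] [ChartedSpace (EuclideanSpace ℝ (Fin n)) M]
  [IsManifold (𝓡 n) ∞ M]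
  {N : Type*} [TopologicalSpace N] [ChartedSpace (EuclideanSpace ℝ (Fin m)) N]
  [IsManifold (𝓡 m) ∞ N] [MeasurableSpace N] [BorelSpace N]
  (g : Bundle.ContMDiffRiemannianMetric (𝓡 n) ∞ (EuclideanSpace ℝ (Fin n))
    (fun x : M ↦ TangentSpace (𝓡 n) x))

lemma exists_open_chartMeasure_lt_top {f : N → M} (hf : ContMDiff (𝓡 m) (𝓡 n) ∞ f) (p : N) :
    ∃ O, IsOpen O ∧ p ∈ O ∧ O ⊆ (extChartAt (𝓡 m) p).source ∧
      chartMeasure (𝓡 m) p (fun y ↦ ENNReal.ofReal (√(gramMatrix g f p y).det)) O < ⊤ := by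
  set φ := extChartAt (𝓡 m) p
  have hc : ContinuousAt (fun y ↦ √(gramMatrix g f p y).det) (φ p) := by
    refine Real.continuous_sqrt.continuousAt.comp ?_
    refine (Continuous.matrix_det continuous_id).continuousAt.comp ?_
    exact (continuousOn_gramMatrix g hf p).continuousAt (extChartAt_target_mem_nhds p)
  obtain ⟨r, hr, hb⟩ := Metric.eventually_nhds_iff_ball.1
    (hc.eventually_lt (continuousAt_const (y := √(gramMatrix g f p (φ p)).det + 1)) (by simp))
  have hO : IsOpen (φ.source ∩ φ ⁻¹' Metric.ball (φ p) r) :=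
    (continuousOn_extChartAt p).isOpen_inter_preimage (isOpen_extChartAt_source p)
      Metric.isOpen_ball
  refine ⟨_, hO, ⟨mem_extChartAt_source p, Metric.mem_ball_self hr⟩, inter_subset_left, ?_⟩
  rw [chartMeasure_apply _ _ _ hO.measurableSet inter_subset_left]
  have hsub : φ '' (φ.source ∩ φ ⁻¹' Metric.ball (φ p) r) ⊆ Metric.ball (φ p) r := by
    rintro _ ⟨y, hy, rfl⟩
    exact hy.2
  calc _ ≤ ∫⁻ y in Metric.ball (φ p) r, ENNReal.ofReal (√(gramMatrix g f p y).det) :=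
        lintegral_mono_set hsub
    _ ≤ ∫⁻ _ in Metric.ball (φ p) r, ENNReal.ofReal (√(gramMatrix g f p (φ p)).det + 1) :=
        setLIntegral_mono' measurableSet_ball fun y hy ↦ ENNReal.ofReal_le_ofReal (hb y hy).le
    _ < ⊤ := by
        rw [setLIntegral_const]
        exact ENNReal.mul_lt_top ENNReal.ofReal_lt_top measure_ball_lt_top

/-- A closed manifold is divided into finitely many measurable pieces of finite volume, each in
the domain of a chart. -/
lemma exists_chart_partition [CompactSpace N] {f : N → M} (hf : ContMDiff (𝓡 m) (𝓡 n) ∞ f) :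
    ∃ (k : ℕ) (p : Fin k → N) (A : Fin k → Set N), (∀ i, MeasurableSet (A i)) ∧
      (∀ i, A i ⊆ (extChartAt (𝓡 m) (p i)).source) ∧ (⋃ i, A i) = univ ∧
      ∑ i, chartMeasure (𝓡 m) (p i)
        (fun y ↦ ENNReal.ofReal (√(gramMatrix g f (p i) y).det)) (A i) < ⊤ ∧
      ∑ i, chartMeasure (𝓡 m) (p i)
        (fun y ↦ ENNReal.ofReal (√(gramMatrix g f (p i) y).det)) (A i) ≤
          inducedVolume (m := m) g f univ := by
  choose O hOo hpO hOs hOf using exists_open_chartMeasure_lt_top g hf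
  obtain ⟨t, ht⟩ := isCompact_univ.elim_finite_subcover O hOo
    (fun p _ ↦ mem_iUnion.2 ⟨p, hpO p⟩)
  let p : Fin t.card → N := fun i ↦ t.equivFin.symm i
  have hcov : ⋃ i, O (p i) = univ := by
    refine eq_univ_of_univ_subset (ht.trans ?_)
    refine iUnion₂_subset fun q hq ↦ ?_
    refine subset_iUnion_of_subset (t.equivFin ⟨q, hq⟩) ?_
    simp [p]
  have hAm : ∀ i, MeasurableSet (disjointed (fun i ↦ O (p i)) i) := fun i ↦
    disjointedRec (fun _ _ h ↦ h.diff (hOo _).measurableSet) (hOo (p i)).measurableSet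
  refine ⟨t.card, p, disjointed (fun i ↦ O (p i)), hAm,
    fun i ↦ (disjointed_subset _ i).trans (hOs _), ?_, ?_, ?_⟩
  · rw [← hcov]
    exact iUnion_disjointed
  · refine ENNReal.sum_lt_top.2 fun i _ ↦ ?_
    exact (measure_mono (disjointed_subset (fun i ↦ O (p i)) i)).trans_lt (hOf (p i))
  -- Only this direction is needed: a supremum of measures dominates each chart measure, and the
  -- pieces are disjoint. Finiteness was obtained from the chart measures directly.
  · calc _ ≤ ∑ i, inducedVolume (m := m) g f (disjointed (fun i ↦ O (p i)) i) := by
          refine Finset.sum_le_sum fun i _ ↦ ?_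
          exact Measure.le_iff'.1 (le_iSup (fun q : N ↦ chartMeasure (𝓡 m) q
            fun y ↦ ENNReal.ofReal (√(gramMatrix g f q y).det)) (p i)) _
      _ = inducedVolume (m := m) g f (⋃ i, disjointed (fun i ↦ O (p i)) i) := by
          rw [measure_iUnion (disjoint_disjointed _) hAm, tsum_fintype]
      _ ≤ _ := measure_mono (subset_univ _)

end Volume

end Crofton

/-! ### Globalization by compactness -/

theorem mainTheorem11
    {d l m n : ℕ} (hdim : m + l = n)
    -- the compact parameter manifold `B`, possibly with boundary, and the smooth measure `ds`
    {HB : Type*} [TopologicalSpace HB]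
    (IB : ModelWithCorners ℝ (EuclideanSpace ℝ (Fin d)) HB)
    {B : Type*} [TopologicalSpace B] [ChartedSpace HB B] [IsManifold IB ∞ B]
    [T2Space B] [CompactSpace B] [MeasurableSpace B] [BorelSpace B]
    (ds : Measure B) (hds : Crofton.IsSmoothMeasure IB ds)
    -- the closed manifold `L`
    {L : Type*} [TopologicalSpace L] [ChartedSpace (EuclideanSpace ℝ (Fin l)) L]
    [IsManifold (𝓡 l) ∞ L] [T2Space L] [CompactSpace L]
    -- the Riemannian manifold `(M, g)`
    {M : Type u} [TopologicalSpace M] [ChartedSpace (EuclideanSpace ℝ (Fin n)) M]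
    [IsManifold (𝓡 n) ∞ M] [T2Space M] [SecondCountableTopology M]
    (g : Bundle.ContMDiffRiemannianMetric (𝓡 n) ∞ (EuclideanSpace ℝ (Fin n))
      (fun x : M ↦ TangentSpace (𝓡 n) x))
    -- the map `Ψ`
    (Ψ : B × L → M) (hΨ : ContMDiff (IB.prod (𝓡 l)) (𝓡 n) ∞ Ψ)
    (hsub : ∀ e : B × L, Function.Surjective (mfderiv (IB.prod (𝓡 l)) (𝓡 n) Ψ e))
    (hemb : ∀ s : B, IsSmoothEmbedding (𝓡 l) (𝓡 n) ∞ (fun x : L ↦ Ψ (s, x))) :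
    ∃ C : NNReal,
      -- the closed submanifold `L'` is the image of the embedding `ι` of the closed manifold `N`
      ∀ (N : Type u) [TopologicalSpace N] [ChartedSpace (EuclideanSpace ℝ (Fin m)) N]
        [IsManifold (𝓡 m) ∞ N] [CompactSpace N] [MeasurableSpace N] [BorelSpace N]
        (ι : N → M), IsSmoothEmbedding (𝓡 m) (𝓡 n) ∞ ι →
        (∀ᵐ s ∂ds, (range (fun x : L ↦ Ψ (s, x)) ∩ range ι).Finite) ∧
        Integrable (fun s ↦ ((range (fun x : L ↦ Ψ (s, x)) ∩ range ι).ncard : ℝ)) ds ∧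
        ENNReal.ofReal (∫ s, ((range (fun x : L ↦ Ψ (s, x)) ∩ range ι).ncard : ℝ) ∂ds)
          ≤ C * Crofton.inducedVolume (m := m) g ι univ := by
  classical
  have hloc := fun e : B × L ↦ Crofton.exists_nhds_crofton (m := m) g hdim hds hΨ e.1 e.2
    (hsub e) (Crofton.mfderiv_injective_of_isImmersionAt ((hemb e.1).isImmersion.isImmersionAt e.2))
  choose E hE c hc using hloc
  -- The cover is fixed before the submanifold is given, so the constant does not depend on it.
  obtain ⟨T, -, hT⟩ := isCompact_univ.elim_nhds_subcover E (fun e _ ↦ hE e)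
  refine ⟨∑ e ∈ T, c e, fun N _ _ _ _ _ _ ι hι ↦ ?_⟩
  have : LocallyCompactSpace M := ChartedSpace.locallyCompactSpace (EuclideanSpace ℝ (Fin n)) M
  -- Any compatible distance will do; it serves only to separate points in the measurability
  -- argument.
  let : MetricSpace M := TopologicalSpace.metrizableSpaceMetric M
  obtain ⟨k, p, A, hAm, hAp, hAu, hAfin, hAle⟩ := Crofton.exists_chart_partition g hι.contMDiff
  set V := ∑ i, Crofton.chartMeasure (𝓡 m) (p i)
    (fun y ↦ ENNReal.ofReal (√(Crofton.gramMatrix g ι (p i) y).det)) (A i)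
  choose h hm hle hint using fun (e : B × L) (i : Fin k) ↦
    hc e N ι hι.contMDiff (p i) (A i) (hAm i) (hAp i)
  let f : B → ℝ≥0∞ := fun s ↦ ((range (fun x : L ↦ Ψ (s, x)) ∩ range ι).encard : ℝ≥0∞)
  have hf : Measurable f := Crofton.measurable_encard_inter hΨ.continuous
    (isCompact_range hι.contMDiff.continuous).isClosed
  have hfle : ∀ s, f s ≤ ∑ e ∈ T, ∑ i, h e i s := by
    intro s
    let S : B × L → Fin k → Set M := fun e i ↦
      {z | (∃ x, (s, x) ∈ E e ∧ Ψ (s, x) = z) ∧ z ∈ ι '' A i}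
    have hsub : range (fun x : L ↦ Ψ (s, x)) ∩ range ι ⊆
        ⋃ e ∈ T, ⋃ i ∈ (Finset.univ : Finset (Fin k)), S e i := by
      rintro z ⟨⟨x, rfl⟩, y, hy⟩
      obtain ⟨e, he, hse⟩ := mem_iUnion₂.1 (hT (mem_univ (s, x)))
      obtain ⟨i, hi⟩ := mem_iUnion.1 (hAu.symm ▸ mem_univ y : y ∈ ⋃ i, A i)
      exact mem_iUnion₂.2 ⟨e, he, mem_iUnion₂.2
        ⟨i, Finset.mem_univ i, ⟨x, hse, rfl⟩, y, hi, hy⟩⟩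
    calc f s ≤ ((⋃ e ∈ T, ⋃ i ∈ (Finset.univ : Finset (Fin k)), S e i).encard : ℝ≥0∞) :=
          ENat.toENNReal_le.2 (encard_le_encard hsub)
      _ ≤ ∑ e ∈ T, ((⋃ i ∈ (Finset.univ : Finset (Fin k)), S e i).encard : ℝ≥0∞) :=
          Crofton.encard_biUnion_le_sum T _
      _ ≤ ∑ e ∈ T, ∑ i, ((S e i).encard : ℝ≥0∞) :=
          Finset.sum_le_sum fun e _ ↦ Crofton.encard_biUnion_le_sum Finset.univ _
      _ ≤ _ := Finset.sum_le_sum fun e _ ↦ Finset.sum_le_sum fun i _ ↦ hle e i s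
  have hfint : ∫⁻ s, f s ∂ds ≤ (∑ e ∈ T, c e : NNReal) * V := by
    calc ∫⁻ s, f s ∂ds ≤ ∫⁻ s, ∑ e ∈ T, ∑ i, h e i s ∂ds := lintegral_mono hfle
      _ = ∑ e ∈ T, ∑ i, ∫⁻ s, h e i s ∂ds := by
          rw [lintegral_finsetSum _ fun e _ ↦ Finset.measurable_sum _ fun i _ ↦ hm e i]
          exact Finset.sum_congr rfl fun e _ ↦ lintegral_finsetSum _ fun i _ ↦ hm e i
      _ ≤ ∑ e ∈ T, ∑ i, c e * Crofton.chartMeasure (𝓡 m) (p i)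
            (fun y ↦ ENNReal.ofReal (√(Crofton.gramMatrix g ι (p i) y).det)) (A i) :=
          Finset.sum_le_sum fun e _ ↦ Finset.sum_le_sum fun i _ ↦ hint e i
      _ = _ := by
          rw [ENNReal.ofNNReal_finsetSum, Finset.sum_mul]
          exact Finset.sum_congr rfl fun e _ ↦ (Finset.mul_sum _ _ _).symm
  have hfne : ∫⁻ s, f s ∂ds ≠ ⊤ :=
    (hfint.trans_lt (ENNReal.mul_lt_top ENNReal.coe_lt_top hAfin)).ne
  -- The equality holds at every `s`: for an infinite intersection both sides take the default value
  -- 0.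
  have hncard : (fun s ↦ ((range (fun x : L ↦ Ψ (s, x)) ∩ range ι).ncard : ℝ)) =
      fun s ↦ (f s).toReal := by
    ext s
    by_cases hfin : (range (fun x : L ↦ Ψ (s, x)) ∩ range ι).Finite
    · simp only [f, ← hfin.cast_ncard_eq]
      simp
    · have hinf : (range (fun x : L ↦ Ψ (s, x)) ∩ range ι).Infinite := hfin
      simp [f, hinf.ncard, hinf.encard_eq]
  have hae := ae_lt_top hf hfne
  refine ⟨?_, ?_, ?_⟩
  · filter_upwards [hae] with s hs
    rw [← encard_lt_top_iff]
    exact ENat.toENNReal_lt_top.1 hs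
  · rw [hncard]
    exact integrable_toReal_of_lintegral_ne_top hf.aemeasurable hfne
  · rw [hncard, integral_toReal hf.aemeasurable hae, ENNReal.ofReal_toReal hfne]
    exact hfint.trans (mul_le_mul_right hAle _)
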